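/- Let $d\in\{1,2,3\}$, $\gamma>0$, $J\ge 0$, and let $\mathbb{R}^d=\bigcup_{j=0}^{J}\overline{\Omega}_j$ be a non-overlapping partition into Lipschitz open sets $\Omega_0,\dots,\Omega_J$ ($\Omega_j\cap\Omega_k=\emptyset$ for $j\ne k$), where $\Omega_j$ is bounded for $j\neq 0$; put $\Gamma=\bigcup_j\partial\Omega_j$. All functions are complex valued, and $n_j$ is the unit normal on $\partial\Omega_j$ pointing out of $\Omega_j$. For a Lipschitz open set $\Omega$ with bounded boundary, equip $H^1(\Omega)$ with $\|v\|_{H^1(\Omega)}^2=\|\nabla v\|_{L^2(\Omega)}^2+\gamma^{-2}\|v\|_{L^2(\Omega)}^2$. Let $H^{1/2}(\partial\Omega)=\{v|_{\partial\Omega}: v\in H^1(\Omega)\}$ with the norm $\|v\|=\min\{\|\varphi\|_{H^1(\Omega)}:\varphi|_{\partial\Omega}=v\}$, let $H^{-1/2}(\partial\Omega)$ be its dual with the dual norm, and write $\langle\cdot,\cdot\rangle_{\partial\Omega}$ for the bilinear duality pairing (no complex conjugation); for $q\in H^{-1/2}(\partial\Omega)$ let $\langle\overline q,v\rangle_{\partial\Omega}=\overline{\langle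 q,\overline v\rangle_{\partial\Omega}}$. For $\psi\in L^2(\Omega)^d$ with $\operatorname{div}\psi\in L^2(\Omega)$ the normal trace $n\cdot\psi|_{\partial\Omega}\in H^{-1/2}(\partial\Omega)$ is given by $\langle n\cdot\psi,w|_{\partial\Omega}\rangle_{\partial\Omega}=\int_\Omega \psi\cdot\nabla w+(\operatorname{div}\psi)\,w\,dx$ for $w\in H^1(\Omega)$. For each $j$ let $T_j:H^{1/2}(\partial\Omega_j)\to H^{-1/2}(\partial\Omega_j)$ be the Dirichlet-to-Neumann map $T_j(v)=n_j\cdot\nabla\phi|_{\partial\Omega_j}$, where $\phi\in H^1(\Omega_j)$ solves $\Delta\phi-\gamma^{-2}\phi=0$ in $\Omega_j$ and $\phi|_{\partial\Omega_j}=v$. Set $$\mathbb{H}_D(\Gamma)=\prod_{j=0}^J H^{1/2}(\partial\Omega_j),\qquad \mathbb{H}_N(\Gamma)=\prod_{j=0}^J H^{-1/2}(\partial\Omega_j),\qquad T=\operatorname{diag}(T_0,\dots,T_J),$$ with $\|p\|_{\mathbb{H}_N(\Gamma)}^2=\sum_j\|p^j\|_{H^{-1/2}(\partial\Omega_j)}^2$,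 and $$\mathbb{X}_D(\Gamma)=\{(\varphi|_{\partial\Omega_j})_{j=0}^J:\varphi\in H^1(\mathbb{R}^d)\},\qquad \mathbb{X}_N(\Gamma)=\{(n_j\cdot\psi|_{\partial\Omega_j})_{j=0}^J:\psi\in L^2(\mathbb{R}^d)^d,\ \operatorname{div}\psi\in L^2(\mathbb{R}^d)\}.$$ Then $T:\mathbb{H}_D(\Gamma)\to\mathbb{H}_N(\Gamma)$ is a well-defined linear bijection, the form $$(p,q)_{\mathbb{H}_N(\Gamma)}=\sum_{j=0}^J\langle T_j^{-1}(p^j),\overline{q}^{\,j}\rangle_{\partial\Omega_j}$$ is a (Hermitian, positive definite) scalar product on $\mathbb{H}_N(\Gamma)$ with $(p,p)_{\mathbb{H}_N(\Gamma)}=\|p\|_{\mathbb{H}_N(\Gamma)}^2$, and $$\mathbb{H}_N(\Gamma)=\mathbb{X}_N(\Gamma)\oplus T(\mathbb{X}_D(\Gamma)),$$ where the sum is direct and orthogonal for this scalar product. -/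

import Mathlib

open MeasureTheory Set Topology
open scoped ContDiff ENNReal

namespace MultiTrace

noncomputable section

/-- Physical space `ℝ^d` with its Euclidean structure. -/
abbrev Space (d : ℕ) := EuclideanSpace ℝ (Fin d)

/-- Complex valued square integrable functions on `Ω`. -/
abbrev L2 {d : ℕ} (Ω : Set (Space d)) := Lp ℂ 2 (volume.restrict Ω)

/-- The classical partial derivative `∂φ/∂x_i`. -/
def pderiv {d : ℕ} (i : Fin d) (φ : Space d → ℂ) (x : Space d) : ℂ :=
  fderiv ℝ φ x (EuclideanSpace.single i 1)

/-- `φ` is (the restriction of) an element of `C^∞_comp(ℝ^d)`. -/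
def IsSmoothComp {d : ℕ} (φ : Space d → ℂ) : Prop :=
  ContDiff ℝ ∞ φ ∧ HasCompactSupport φ

/-- `φ` is a test function on `Ω`: smooth, with compact support contained in `Ω`. -/
def IsTest {d : ℕ} (Ω : Set (Space d)) (φ : Space d → ℂ) : Prop :=
  ContDiff ℝ ∞ φ ∧ HasCompactSupport φ ∧ tsupport φ ⊆ Ω

/-- `g` is the weak partial derivative `∂_i v` on `Ω`. -/
def HasWeakDeriv {d : ℕ} (Ω : Set (Space d)) (i : Fin d) (v g : Space d → ℂ) : Prop :=
  ∀ φ : Space d → ℂ, IsTest Ω φ →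
    ∫ x in Ω, v x * pderiv i φ x = -∫ x in Ω, g x * φ x

/-- `f` is the weak divergence of the vector field `ψ` on `Ω`. -/
def HasWeakDiv {d : ℕ} (Ω : Set (Space d)) (ψ : Fin d → Space d → ℂ) (f : Space d → ℂ) : Prop :=
  ∀ φ : Space d → ℂ, IsTest Ω φ →
    ∫ x in Ω, ∑ i, ψ i x * pderiv i φ x = -∫ x in Ω, f x * φ x

/-- `ψ ∈ H(div, Ω)` with `div ψ = f`. -/
structure MemHDiv {d : ℕ} (Ω : Set (Space d)) (ψ : Fin d → Space d → ℂ) (f : Space d → ℂ) :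
    Prop where
  memLp : ∀ i, MemLp (ψ i) 2 (volume.restrict Ω)
  memLp_div : MemLp f 2 (volume.restrict Ω)
  weakDiv : HasWeakDiv Ω ψ f

section Facts

variable {d : ℕ}

lemma IsTest.smooth {Ω : Set (Space d)} {φ : Space d → ℂ} (h : IsTest Ω φ) : IsSmoothComp φ :=
  ⟨h.1, h.2.1⟩

lemma IsSmoothComp.memLp {φ : Space d → ℂ} (h : IsSmoothComp φ) (Ω : Set (Space d)) :
    MemLp φ 2 (volume.restrict Ω) :=
  (h.1.continuous.memLp_of_hasCompactSupport h.2).restrict Ω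

lemma IsSmoothComp.memLp_pderiv {φ : Space d → ℂ} (h : IsSmoothComp φ) (Ω : Set (Space d))
    (i : Fin d) : MemLp (pderiv i φ) 2 (volume.restrict Ω) := by
  refine MemLp.restrict Ω (Continuous.memLp_of_hasCompactSupport ?_ ?_)
  · exact (h.1.continuous_fderiv (by simp)).clm_apply continuous_const
  · exact h.2.fderiv_apply (𝕜 := ℝ) _

lemma integrable_mul_of_memLp {Ω : Set (Space d)} {f g : Space d → ℂ}
    (hf : MemLp f 2 (volume.restrict Ω)) (hg : MemLp g 2 (volume.restrict Ω)) :
    Integrable (fun x => f x * g x) (volume.restrict Ω) :=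
  hf.integrable_mul hg

lemma HasWeakDeriv.congr {Ω : Set (Space d)} {i : Fin d} {v v' g g' : Space d → ℂ}
    (hv : v =ᵐ[volume.restrict Ω] v') (hg : g =ᵐ[volume.restrict Ω] g')
    (h : HasWeakDeriv Ω i v g) : HasWeakDeriv Ω i v' g' := by
  intro φ hφ
  have e1 : ∫ x in Ω, v x * pderiv i φ x = ∫ x in Ω, v' x * pderiv i φ x :=
    integral_congr_ae (hv.mul (Filter.EventuallyEq.refl _ (pderiv i φ)))
  have e2 : ∫ x in Ω, g x * φ x = ∫ x in Ω, g' x * φ x :=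
    integral_congr_ae (hg.mul (Filter.EventuallyEq.refl _ φ))
  rw [← e1, ← e2]
  exact h φ hφ

lemma HasWeakDeriv.add {Ω : Set (Space d)} {i : Fin d} {v v' g g' : Space d → ℂ}
    (hv : MemLp v 2 (volume.restrict Ω)) (hv' : MemLp v' 2 (volume.restrict Ω))
    (hg : MemLp g 2 (volume.restrict Ω)) (hg' : MemLp g' 2 (volume.restrict Ω))
    (h : HasWeakDeriv Ω i v g) (h' : HasWeakDeriv Ω i v' g') :
    HasWeakDeriv Ω i (v + v') (g + g') := by
  intro φ hφ
  have h1 := hφ.smooth.memLp Ω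
  have h2 := hφ.smooth.memLp_pderiv Ω i
  simp only [Pi.add_apply, add_mul]
  rw [integral_add (integrable_mul_of_memLp hv h2) (integrable_mul_of_memLp hv' h2),
    integral_add (integrable_mul_of_memLp hg h1) (integrable_mul_of_memLp hg' h1),
    h φ hφ, h' φ hφ]
  ring

lemma HasWeakDeriv.smul {Ω : Set (Space d)} {i : Fin d} {v g : Space d → ℂ} (c : ℂ)
    (h : HasWeakDeriv Ω i v g) : HasWeakDeriv Ω i (c • v) (c • g) := by
  intro φ hφ
  simp only [Pi.smul_apply, smul_eq_mul, mul_assoc]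
  rw [integral_const_mul, integral_const_mul, h φ hφ]
  ring

lemma pderiv_star {φ : Space d → ℂ} (h : IsSmoothComp φ) (i : Fin d) (x : Space d) :
    pderiv i (star φ) x = star (pderiv i φ x) := by
  have h1 : HasFDerivAt φ (fderiv ℝ φ x) x :=
    ((h.1.differentiable (by simp)) x).hasFDerivAt
  have h2 : HasFDerivAt (fun y => Complex.conjCLE (φ y))
      ((Complex.conjCLE : ℂ →L[ℝ] ℂ).comp (fderiv ℝ φ x)) x :=
    (Complex.conjCLE : ℂ →L[ℝ] ℂ).hasFDerivAt.comp x h1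
  have h3 : star φ = fun y => Complex.conjCLE (φ y) := by
    ext y; simp
  simp only [pderiv]
  rw [h3, h2.fderiv]
  simp

lemma IsSmoothComp.star {φ : Space d → ℂ} (h : IsSmoothComp φ) : IsSmoothComp (star φ) := by
  have h3 : Star.star φ = fun y => Complex.conjCLE (φ y) := by
    ext y; simp
  rw [h3]
  exact ⟨(Complex.conjCLE : ℂ →L[ℝ] ℂ).contDiff.comp h.1, h.2.comp_left (by simp)⟩

lemma IsTest.star {Ω : Set (Space d)} {φ : Space d → ℂ} (h : IsTest Ω φ) :
    IsTest Ω (star φ) := by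
  refine ⟨h.smooth.star.1, h.smooth.star.2, ?_⟩
  have : Function.support (Star.star φ) = Function.support φ := by
    ext y; simp
  rw [tsupport, this]
  exact h.2.2

lemma HasWeakDeriv.star {Ω : Set (Space d)} {i : Fin d} {v g : Space d → ℂ}
    (h : HasWeakDeriv Ω i v g) : HasWeakDeriv Ω i (star v) (star g) := by
  intro φ hφ
  have h1 := h _ hφ.star
  have h2 : (fun x => (Star.star v) x * pderiv i φ x) =
      fun x => (starRingEnd ℂ) (v x * pderiv i (Star.star φ) x) := by
    ext x
    rw [pderiv_star hφ.smooth]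
    simp
  have h3 : (fun x => (Star.star g) x * φ x) =
      fun x => (starRingEnd ℂ) (g x * (Star.star φ) x) := by
    ext x
    simp
  rw [h2, h3, integral_conj, integral_conj, h1, map_neg]

lemma HasWeakDiv.add {Ω : Set (Space d)} {ψ ψ' : Fin d → Space d → ℂ} {f f' : Space d → ℂ}
    (h : MemHDiv Ω ψ f) (h' : MemHDiv Ω ψ' f') : HasWeakDiv Ω (ψ + ψ') (f + f') := by
  intro φ hφ
  have h1 := hφ.smooth.memLp Ω
  have h2 := fun i => hφ.smooth.memLp_pderiv Ω i
  simp only [Pi.add_apply, add_mul, Finset.sum_add_distrib]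
  rw [integral_add
      (integrable_finsetSum _ fun i _ => integrable_mul_of_memLp (h.memLp i) (h2 i))
      (integrable_finsetSum _ fun i _ => integrable_mul_of_memLp (h'.memLp i) (h2 i)),
    integral_add (integrable_mul_of_memLp h.memLp_div h1)
      (integrable_mul_of_memLp h'.memLp_div h1), h.weakDiv φ hφ, h'.weakDiv φ hφ]
  ring

lemma MemHDiv.add {Ω : Set (Space d)} {ψ ψ' : Fin d → Space d → ℂ} {f f' : Space d → ℂ}
    (h : MemHDiv Ω ψ f) (h' : MemHDiv Ω ψ' f') : MemHDiv Ω (ψ + ψ') (f + f') :=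
  ⟨fun i => (h.memLp i).add (h'.memLp i), h.memLp_div.add h'.memLp_div, HasWeakDiv.add h h'⟩

lemma MemHDiv.smul {Ω : Set (Space d)} {ψ : Fin d → Space d → ℂ} {f : Space d → ℂ} (c : ℂ)
    (h : MemHDiv Ω ψ f) : MemHDiv Ω (c • ψ) (c • f) := by
  refine ⟨fun i => (h.memLp i).const_smul c, h.memLp_div.const_smul c, ?_⟩
  intro φ hφ
  simp only [Pi.smul_apply, smul_eq_mul, mul_assoc, ← Finset.mul_sum]
  rw [integral_const_mul, integral_const_mul, h.weakDiv φ hφ]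
  ring

lemma MemHDiv.zero (Ω : Set (Space d)) : MemHDiv Ω (0 : Fin d → Space d → ℂ) 0 :=
  ⟨fun _ => MemLp.zero, MemLp.zero, fun _ _ => by simp⟩

lemma ae_eq_of_univ {Ω : Set (Space d)} {f g : Space d → ℂ}
    (h : f =ᵐ[volume.restrict (univ : Set (Space d))] g) : f =ᵐ[volume.restrict Ω] g :=
  ae_mono (Measure.restrict_mono (subset_univ _) le_rfl) h

lemma norm_star_sub {Ω : Set (Space d)} (f g : L2 Ω) : ‖star f - star g‖ = ‖f - g‖ := by
  rw [Lp.norm_def, Lp.norm_def]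
  congr 1
  refine eLpNorm_congr_norm_ae ?_
  filter_upwards [Lp.coeFn_sub (star f) (star g), Lp.coeFn_sub f g, Lp.coeFn_star f,
    Lp.coeFn_star g] with x h1 h2 h3 h4
  rw [h1, h2, Pi.sub_apply, Pi.sub_apply, h3, h4, Pi.star_apply, Pi.star_apply, ← star_sub,
    norm_star]

end Facts

/-! ### The Sobolev space `H¹(Ω)` -/

/-- The space in which the pairs `(γ⁻¹ v, ∇v)` live: component `none` is `γ⁻¹ v`,
component `some i` is `∂_i v`. -/
abbrev Jet {d : ℕ} (Ω : Set (Space d)) := PiLp 2 (fun _ : Option (Fin d) => L2 Ω)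

/-- The Sobolev space `H¹(Ω)`. A function `v` is stored as `(γ⁻¹ v, ∂₁ v, …, ∂_d v)`, so that the
norm inherited from the `ℓ²` sum is `‖v‖² = ‖∇v‖² + γ⁻² ‖v‖²`. -/
def H1 {d : ℕ} (γ : ℝ) (Ω : Set (Space d)) : Submodule ℂ (Jet Ω) where
  carrier := {w | ∀ i : Fin d, HasWeakDeriv Ω i ((γ : ℂ) • w none : L2 Ω) (w (some i))}
  zero_mem' := by
    intro i
    have h0 : ((0 : L2 Ω) : Space d → ℂ) =ᵐ[volume.restrict Ω] 0 := Lp.coeFn_zero _ _ _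
    simp only [PiLp.zero_apply, smul_zero]
    exact HasWeakDeriv.congr (v := 0) (g := 0) h0.symm h0.symm (fun φ _ => by simp)
  add_mem' := by
    intro a b ha hb i
    simp only [PiLp.add_apply, smul_add]
    exact ((ha i).add (Lp.memLp _) (Lp.memLp _) (Lp.memLp _) (Lp.memLp _) (hb i)).congr
      (Lp.coeFn_add _ _).symm (Lp.coeFn_add _ _).symm
  smul_mem' := by
    intro c a ha i
    simp only [PiLp.smul_apply, smul_comm _ c]
    exact ((ha i).smul c).congr (Lp.coeFn_smul _ _).symm (Lp.coeFn_smul _ _).symm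

/-- The function `v` underlying an element of `H¹(Ω)`. -/
def fnOf {d : ℕ} {γ : ℝ} {Ω : Set (Space d)} (w : H1 γ Ω) : L2 Ω :=
  (γ : ℂ) • w.1 none

/-- The weak gradient `∇v` of an element of `H¹(Ω)`. -/
def gradOf {d : ℕ} {γ : ℝ} {Ω : Set (Space d)} (w : H1 γ Ω) (i : Fin d) : L2 Ω :=
  w.1 (some i)

/-- Complex conjugation on `H¹(Ω)`. -/
def conjH1 {d : ℕ} {γ : ℝ} {Ω : Set (Space d)} (w : H1 γ Ω) : H1 γ Ω :=
  ⟨WithLp.toLp 2 (fun k => star (w.1 k)), by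
    intro i
    refine (w.2 i).star.congr ?_ (Lp.coeFn_star _).symm
    filter_upwards [Lp.coeFn_smul (γ : ℂ) (w.1 none), Lp.coeFn_smul (γ : ℂ) (star (w.1 none)),
      Lp.coeFn_star (w.1 none)] with x h1 h2 h3
    simp only [Pi.star_apply, h1, h2, h3, Pi.smul_apply, smul_eq_mul, star_mul']
    simp⟩

/-! ### Traces on the boundary -/

/-- The surface measure on `∂Ω`: the `(d-1)`-dimensional Hausdorff measure restricted to the
boundary (Mathlib's normalisation, i.e. up to a positive constant that depends only on `d`). -/
def surface {d : ℕ} (Ω : Set (Space d)) : Measure (Space d) :=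
  (Measure.hausdorffMeasure ((d : ℝ) - 1)).restrict (frontier Ω)

/-- The pairs `(φ|_Ω, φ|_∂Ω)` in `H¹(Ω) × L²(∂Ω)`, for `φ ∈ C^∞_comp(ℝ^d)`. -/
def smoothTraceGraph {d : ℕ} (γ : ℝ) (Ω : Set (Space d)) :
    Submodule ℂ (H1 γ Ω × Lp ℂ 2 (surface Ω)) where
  carrier := {a | ∃ φ : Space d → ℂ, IsSmoothComp φ ∧
    fnOf a.1 =ᵐ[volume.restrict Ω] φ ∧ a.2 =ᵐ[surface Ω] φ}
  zero_mem' := by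
    refine ⟨0, ⟨contDiff_const, HasCompactSupport.zero⟩, ?_, Lp.coeFn_zero _ _ _⟩
    have : fnOf (0 : H1 γ Ω) = 0 := by simp [fnOf]
    simp only [Prod.fst_zero, this]
    exact Lp.coeFn_zero _ _ _
  add_mem' := by
    rintro a b ⟨φ, hφ, h1, h2⟩ ⟨χ, hχ, h3, h4⟩
    refine ⟨φ + χ, ⟨hφ.1.add hχ.1, hφ.2.add hχ.2⟩, ?_, (Lp.coeFn_add _ _).trans (h2.add h4)⟩
    have : fnOf (a + b).1 = fnOf a.1 + fnOf b.1 := by simp [fnOf]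
    rw [this]
    exact (Lp.coeFn_add _ _).trans (h1.add h3)
  smul_mem' := by
    rintro c a ⟨φ, hφ, h1, h2⟩
    refine ⟨c • φ, ⟨hφ.1.const_smul c, ?_⟩, ?_, (Lp.coeFn_smul _ _).trans (h2.const_smul c)⟩
    · exact hφ.2.smul_left (f := fun _ => c)
    have : fnOf (c • a).1 = c • fnOf a.1 := smul_comm (γ : ℂ) c (a.1.1 none)
    rw [this]
    exact (Lp.coeFn_smul _ _).trans (h1.const_smul c)

/-- The graph of the boundary trace operator `H¹(Ω) → L²(∂Ω)`, `v ↦ v|_∂Ω`, which is the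
continuous extension of the restriction of smooth functions to `∂Ω`. -/
def traceGraph {d : ℕ} (γ : ℝ) (Ω : Set (Space d)) :
    Submodule ℂ (H1 γ Ω × Lp ℂ 2 (surface Ω)) :=
  (smoothTraceGraph γ Ω).topologicalClosure

/-- The functions `v ∈ H¹(Ω)` with `v|_∂Ω = 0`. -/
def traceZero {d : ℕ} (γ : ℝ) (Ω : Set (Space d)) : Submodule ℂ (H1 γ Ω) :=
  (traceGraph γ Ω).comap (LinearMap.inl ℂ (H1 γ Ω) (Lp ℂ 2 (surface Ω)))

lemma conjH1_mem_traceZero {d : ℕ} {γ : ℝ} {Ω : Set (Space d)} {w : H1 γ Ω}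
    (hw : w ∈ traceZero γ Ω) : conjH1 w ∈ traceZero γ Ω := by
  have hiso : Isometry (fun g : Lp ℂ 2 (surface Ω) => star g) := by
    refine Isometry.of_dist_eq fun f g => ?_
    rw [dist_eq_norm, dist_eq_norm, Lp.norm_def, Lp.norm_def]
    congr 1
    refine eLpNorm_congr_norm_ae ?_
    filter_upwards [Lp.coeFn_sub (star f) (star g), Lp.coeFn_sub f g, Lp.coeFn_star f,
      Lp.coeFn_star g] with x h1 h2 h3 h4
    rw [h1, h2, Pi.sub_apply, Pi.sub_apply, h3, h4, Pi.star_apply, Pi.star_apply, ← star_sub,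
      norm_star]
  have hconj : Isometry (conjH1 : H1 γ Ω → H1 γ Ω) := by
    refine Isometry.of_dist_eq fun f g => ?_
    rw [Subtype.dist_eq, Subtype.dist_eq, PiLp.dist_eq_of_L2, PiLp.dist_eq_of_L2]
    simp only [conjH1, dist_eq_norm, norm_star_sub]
  have hcont : Continuous (fun a : H1 γ Ω × Lp ℂ 2 (surface Ω) => (conjH1 a.1, star a.2)) :=
    (hconj.continuous.comp continuous_fst).prodMk (hiso.continuous.comp continuous_snd)
  have hmem : (w, (0 : Lp ℂ 2 (surface Ω))) ∈
      closure (smoothTraceGraph γ Ω : Set (H1 γ Ω × Lp ℂ 2 (surface Ω))) := hw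
  have key := map_mem_closure hcont hmem
    (t := (smoothTraceGraph γ Ω : Set (H1 γ Ω × Lp ℂ 2 (surface Ω)))) ?_
  · have h0 : star (0 : Lp ℂ 2 (surface Ω)) = 0 := by
      apply Lp.ext
      filter_upwards [Lp.coeFn_star (0 : Lp ℂ 2 (surface Ω)), Lp.coeFn_zero ℂ 2 (surface Ω)]
        with x h1 h2
      rw [h1, Pi.star_apply, h2]
      simp
    simp only [h0] at key
    exact key
  · rintro a ⟨φ, hφ, h1, h2⟩
    refine ⟨star φ, hφ.star, ?_, ?_⟩
    · filter_upwards [h1, Lp.coeFn_smul (γ : ℂ) (a.1.1 none),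
        Lp.coeFn_smul (γ : ℂ) (star (a.1.1 none)), Lp.coeFn_star (a.1.1 none)] with x h3 h4 h5 h6
      have e1 : fnOf (conjH1 a.1) = (γ : ℂ) • star (a.1.1 none) := rfl
      have e2 : fnOf a.1 = (γ : ℂ) • a.1.1 none := rfl
      rw [e2, h4] at h3
      rw [e1, h5, Pi.star_apply, ← h3]
      simp [h6]
    · filter_upwards [h2, Lp.coeFn_star a.2] with x h3 h4
      rw [h4, Pi.star_apply, Pi.star_apply, h3]

/-- The Dirichlet trace space `H^{1/2}(∂Ω) = {v|_∂Ω : v ∈ H¹(Ω)}`: elements of `H¹(Ω)`, two of them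
being identified when the trace on `∂Ω` of their difference vanishes. The quotient norm is
`‖v‖ = inf {‖φ‖_{H¹(Ω)} : φ|_∂Ω = v}`. -/
abbrev DirTrace {d : ℕ} (γ : ℝ) (Ω : Set (Space d)) := H1 γ Ω ⧸ traceZero γ Ω

/-- The Dirichlet trace `v ↦ v|_∂Ω` from `H¹(Ω)` onto `H^{1/2}(∂Ω)`. -/
def trace {d : ℕ} {γ : ℝ} {Ω : Set (Space d)} : H1 γ Ω →ₗ[ℂ] DirTrace γ Ω :=
  (traceZero γ Ω).mkQ

/-- Complex conjugation on `H^{1/2}(∂Ω)`, i.e. `v|_∂Ω ↦ (conj v)|_∂Ω`. -/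
def conjDir {d : ℕ} {γ : ℝ} {Ω : Set (Space d)} : DirTrace γ Ω → DirTrace γ Ω :=
  Quotient.map' conjH1 (by
    intro a b hab
    rw [Submodule.quotientRel_def] at hab ⊢
    have h := conjH1_mem_traceZero hab
    have e : conjH1 (a - b) = conjH1 a - conjH1 b := by
      apply Subtype.ext
      ext1 k
      apply Lp.ext
      change (star (a.1 k - b.1 k) : L2 Ω) =ᵐ[volume.restrict Ω]
        (star (a.1 k) - star (b.1 k) : L2 Ω)
      filter_upwards [Lp.coeFn_star (a.1 k - b.1 k), Lp.coeFn_sub (a.1 k) (b.1 k),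
        Lp.coeFn_sub (star (a.1 k)) (star (b.1 k)), Lp.coeFn_star (a.1 k),
        Lp.coeFn_star (b.1 k)] with x h1 h2 h3 h4 h5
      rw [h1, h3, Pi.star_apply, h2, Pi.sub_apply, Pi.sub_apply, h4, h5, star_sub]
      rfl
    rwa [e] at h)

/-- The Neumann trace space `H^{-1/2}(∂Ω)`: the (topological, complex linear) dual of
`H^{1/2}(∂Ω)` with the dual norm. The bilinear pairing `⟨p, v⟩_∂Ω` is `p v`. -/
abbrev NeuTrace {d : ℕ} (γ : ℝ) (Ω : Set (Space d)) := StrongDual ℂ (DirTrace γ Ω)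

/-- `p = n · ψ|_∂Ω` for a field `ψ ∈ H(div, Ω)` with `div ψ = f`: the normal trace of `ψ`, with `n`
the outward unit normal, is defined by Green's formula
`⟨p, w|_∂Ω⟩ = ∫_Ω ψ · ∇w + (div ψ) w` for all `w ∈ H¹(Ω)`. -/
def IsNormalTrace {d : ℕ} (γ : ℝ) (Ω : Set (Space d)) (ψ : Fin d → Space d → ℂ) (f : Space d → ℂ)
    (p : NeuTrace γ Ω) : Prop :=
  ∀ w : H1 γ Ω, p (trace w) = ∫ x in Ω, ((∑ i, ψ i x * gradOf w i x) + f x * fnOf w x)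

/-- `p = T_Ω(v)`, where `T_Ω : H^{1/2}(∂Ω) → H^{-1/2}(∂Ω)` is the Dirichlet-to-Neumann map of the
operator `-Δ + γ⁻²`: `p = n · ∇φ|_∂Ω` where `φ ∈ H¹(Ω)`, `Δφ - γ⁻² φ = 0` in `Ω`, `φ|_∂Ω = v`. -/
def IsDtN {d : ℕ} (γ : ℝ) (Ω : Set (Space d)) (v : DirTrace γ Ω) (p : NeuTrace γ Ω) : Prop :=
  ∃ φ : H1 γ Ω, trace φ = v ∧
    HasWeakDiv Ω (fun i => gradOf φ i) (fun x => (γ : ℂ)⁻¹ ^ 2 * fnOf φ x) ∧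
    IsNormalTrace γ Ω (fun i => gradOf φ i) (fun x => (γ : ℂ)⁻¹ ^ 2 * fnOf φ x) p

/-! ### Geometry -/

/-- `Ω` is a Lipschitz open set: near each boundary point it is the set of points lying strictly on
one side of the graph of a Lipschitz function, in the direction of some unit vector `e` (`h` is a
function of the coordinates orthogonal to `e`). -/
def IsLipschitzOpen {d : ℕ} (Ω : Set (Space d)) : Prop :=
  IsOpen Ω ∧ ∀ x ∈ frontier Ω, ∃ (e : Space d) (h : Space d → ℝ), ‖e‖ = 1 ∧
    (∃ K, LipschitzWith K h) ∧ (∀ (y : Space d) (t : ℝ), h (y + t • e) = h y) ∧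
    ∃ U ∈ 𝓝 x, ∀ y ∈ U, (y ∈ Ω ↔ inner ℝ y e < h y)

/-- A non-overlapping partition of `ℝ^d` into Lipschitz subdomains `Ω_0, …, Ω_J`, all of them bounded
except possibly `Ω_0`. -/
structure IsLipschitzPartition {d J : ℕ} (Ω : Fin (J + 1) → Set (Space d)) : Prop where
  lipschitz : ∀ j, IsLipschitzOpen (Ω j)
  bounded : ∀ j, j ≠ 0 → Bornology.IsBounded (Ω j)
  disjoint : ∀ j k, j ≠ k → Disjoint (Ω j) (Ω k)
  cover : ⋃ j, closure (Ω j) = univ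

/-! ### Multi-trace and single-trace spaces -/

/-- The Dirichlet multi-trace space `ℍ_D(Γ) = ∏_j H^{1/2}(∂Ω_j)`. -/
abbrev MultiDir {d J : ℕ} (γ : ℝ) (Ω : Fin (J + 1) → Set (Space d)) :=
  PiLp 2 (fun j => DirTrace γ (Ω j))

/-- The Neumann multi-trace space `ℍ_N(Γ) = ∏_j H^{-1/2}(∂Ω_j)`. -/
abbrev MultiNeu {d J : ℕ} (γ : ℝ) (Ω : Fin (J + 1) → Set (Space d)) :=
  PiLp 2 (fun j => NeuTrace γ (Ω j))

/-- The Dirichlet single-trace space `𝕏_D(Γ)`: the tuples `(φ|_∂Ω_j)_j` for `φ ∈ H¹(ℝ^d)`. -/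
def singleDir {d J : ℕ} (γ : ℝ) (Ω : Fin (J + 1) → Set (Space d)) :
    Submodule ℂ (MultiDir γ Ω) where
  carrier := {v | ∃ φ : H1 γ (univ : Set (Space d)), ∀ j, ∃ w : H1 γ (Ω j),
    fnOf w =ᵐ[volume.restrict (Ω j)] fnOf φ ∧ v j = trace w}
  zero_mem' := by
    refine ⟨0, fun j => ⟨0, ?_, by simp⟩⟩
    have e1 : fnOf (0 : H1 γ (Ω j)) = 0 := by simp [fnOf]
    have e2 : fnOf (0 : H1 γ (univ : Set (Space d))) = 0 := by simp [fnOf]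
    rw [e1, e2]
    exact (Lp.coeFn_zero _ _ _).trans (ae_eq_of_univ (Lp.coeFn_zero _ _ _)).symm
  add_mem' := by
    rintro a b ⟨φ, hφ⟩ ⟨χ, hχ⟩
    refine ⟨φ + χ, fun j => ?_⟩
    obtain ⟨w, h1, h2⟩ := hφ j
    obtain ⟨z, h3, h4⟩ := hχ j
    refine ⟨w + z, ?_, by simp [h2, h4]⟩
    have e1 : fnOf (w + z) = fnOf w + fnOf z := by simp [fnOf]
    have e2 : fnOf (φ + χ) = fnOf φ + fnOf χ := by simp [fnOf]
    rw [e1, e2]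
    exact ((Lp.coeFn_add _ _).trans (h1.add h3)).trans
      (ae_eq_of_univ (Lp.coeFn_add (fnOf φ) (fnOf χ))).symm
  smul_mem' := by
    rintro c a ⟨φ, hφ⟩
    refine ⟨c • φ, fun j => ?_⟩
    obtain ⟨w, h1, h2⟩ := hφ j
    refine ⟨c • w, ?_, by simp [h2]⟩
    have e1 : fnOf (c • w) = c • fnOf w := smul_comm (γ : ℂ) c (w.1 none)
    have e2 : fnOf (c • φ) = c • fnOf φ := smul_comm (γ : ℂ) c (φ.1 none)
    rw [e1, e2]
    exact ((Lp.coeFn_smul _ _).trans (h1.const_smul c)).trans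
      (ae_eq_of_univ (Lp.coeFn_smul c (fnOf φ))).symm

lemma integrable_green {d : ℕ} {γ : ℝ} {Ω : Set (Space d)} {ψ : Fin d → Space d → ℂ}
    {f : Space d → ℂ} (h : MemHDiv univ ψ f) (w : H1 γ Ω) :
    Integrable (fun x => (∑ i, ψ i x * gradOf w i x) + f x * fnOf w x) (volume.restrict Ω) := by
  have hr : volume.restrict Ω ≤ (volume : Measure (Space d)).restrict univ :=
    Measure.restrict_mono (subset_univ _) le_rfl
  exact (integrable_finsetSum _ fun i _ =>
      integrable_mul_of_memLp ((h.memLp i).mono_measure hr) (Lp.memLp _)).add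
    (integrable_mul_of_memLp (h.memLp_div.mono_measure hr) (Lp.memLp _))

lemma IsNormalTrace.add {d : ℕ} {γ : ℝ} {Ω : Set (Space d)} {ψ ψ' : Fin d → Space d → ℂ}
    {f f' : Space d → ℂ} {p p' : NeuTrace γ Ω} (h : MemHDiv univ ψ f) (h' : MemHDiv univ ψ' f')
    (hp : IsNormalTrace γ Ω ψ f p) (hp' : IsNormalTrace γ Ω ψ' f' p') :
    IsNormalTrace γ Ω (ψ + ψ') (f + f') (p + p') := by
  intro w
  rw [_root_.add_apply, hp w, hp' w,
    ← integral_add (integrable_green h w) (integrable_green h' w)]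
  congr 1
  ext x
  simp only [Pi.add_apply, add_mul, Finset.sum_add_distrib]
  ring

lemma IsNormalTrace.smul {d : ℕ} {γ : ℝ} {Ω : Set (Space d)} {ψ : Fin d → Space d → ℂ}
    {f : Space d → ℂ} {p : NeuTrace γ Ω} (c : ℂ) (hp : IsNormalTrace γ Ω ψ f p) :
    IsNormalTrace γ Ω (c • ψ) (c • f) (c • p) := by
  intro w
  change c * p (trace w) = _
  rw [hp w, ← integral_const_mul]
  congr 1
  ext x
  simp only [Pi.smul_apply, smul_eq_mul, mul_add, Finset.mul_sum, mul_assoc]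

lemma IsNormalTrace.zero {d : ℕ} {γ : ℝ} {Ω : Set (Space d)} :
    IsNormalTrace γ Ω 0 0 (0 : NeuTrace γ Ω) := by
  intro w
  rw [_root_.zero_apply]
  simp

/-- The Neumann single-trace space `𝕏_N(Γ)`: the tuples `(n_j · ψ|_∂Ω_j)_j` for
`ψ ∈ H(div, ℝ^d)`. -/
def singleNeu {d J : ℕ} (γ : ℝ) (Ω : Fin (J + 1) → Set (Space d)) :
    Submodule ℂ (MultiNeu γ Ω) where
  carrier := {q | ∃ (ψ : Fin d → Space d → ℂ) (f : Space d → ℂ), MemHDiv univ ψ f ∧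
    ∀ j, IsNormalTrace γ (Ω j) ψ f (q j)}
  zero_mem' := ⟨0, 0, MemHDiv.zero _, fun _ => IsNormalTrace.zero⟩
  add_mem' := by
    rintro a b ⟨ψ, f, h, ha⟩ ⟨ψ', f', h', hb⟩
    exact ⟨ψ + ψ', f + f', h.add h', fun j => (ha j).add h h' (hb j)⟩
  smul_mem' := by
    rintro c a ⟨ψ, f, h, ha⟩
    exact ⟨c • ψ, c • f, h.smul c, fun j => (ha j).smul c⟩

/-- The scalar product `(p, q) = ∑_j ⟨T_j⁻¹(p^j), conj(q^j)⟩_∂Ω_j` on `ℍ_N(Γ)`, where the conjugate of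
`q ∈ H^{-1/2}` is given by `⟨conj q, v⟩ = conj ⟨q, conj v⟩`. The argument `S` stands for `T⁻¹`. -/
def neuInner {d J : ℕ} {γ : ℝ} {Ω : Fin (J + 1) → Set (Space d)}
    (S : MultiNeu γ Ω → MultiDir γ Ω) (p q : MultiNeu γ Ω) : ℂ :=
  ∑ j, (starRingEnd ℂ) (q j (conjDir (S p j)))

end

end MultiTrace

/-!
The decomposition is the Riesz representation theorem for a functional on `H¹(ℝ^d)`, read on each
subdomain. The Hermitian product of `H¹(Ω)` is the form of the operator `-Δ + γ⁻²`:
`⟨conj φ, w⟩ = ∫_Ω ∇φ · ∇w + γ⁻² φ w` (`inner_conjH1`). A Neumann datum `p` on `∂Ω` is a functional on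
`H¹(Ω)` that vanishes on functions of trace zero, so its Riesz representative gives the solution
`neumannSol p` of the Neumann problem, and the functions orthogonal to trace zero are exactly these
solutions. The map `ntd : p ↦ neumannSol p|_∂Ω` is bijective, its inverse is the
Dirichlet-to-Neumann map (`isDtN_iff`), and the form `(p, q)` on `ℍ_N(Γ)` is
`∑_j ⟨neumannSol q^j, neumannSol p^j⟩` (`neuInner_eq`), which makes it a scalar product with the right
norm.

Orthogonality of `𝕏_N(Γ)` and `T(𝕏_D(Γ))` is Green's formula `∫ ψ · ∇φ + (div ψ) φ = 0` on `ℝ^d`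
(`green_univ`), obtained by cutting off and mollifying `φ`; it is split over the subdomains, whose
boundaries are null sets.

Given `p ∈ ℍ_N(Γ)`, let `φ ∈ H¹(ℝ^d)` represent `W ↦ ∑_j ⟨p^j, W|_∂Ω_j⟩`. A function with trace zero on
`∂Ω_j` extends by zero to `H¹(ℝ^d)` (`exists_zero_extension`) and the functional vanishes on the
extension, so `φ|_Ω_j` is orthogonal to trace zero, that is, `φ|_Ω_j = neumannSol t^j`. Then
`t = T((φ|_∂Ω_j)_j)` lies in `T(𝕏_D(Γ))`, and `p - t` annihilates the traces of `H¹(ℝ^d)`, which says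
that the gradients of its Neumann solutions glue to a field in `H(div, ℝ^d)`; hence
`p - t ∈ 𝕏_N(Γ)`.

The analytic core is extension by zero. Since the trace is the closure of restriction of smooth
functions, one needs `|∫_Ω ∂_i(φ η)| ≤ C ‖φ‖_{L²(∂Ω)}` for smooth `φ` and `η` supported near a boundary
point. The left side is compared with difference quotients: `Ω` and its translate by `t v` differ
locally in a slab of width `O(t)` around a Lipschitz graph
(`AxisCoords.enorm_setIntegral_fderiv_le`). The orthogonal projection of the graph is nonexpansive,
so the Lebesgue measure of the projection of a piece of the graph is at most its Hausdorff measure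
(`AxisCoords.map_graphMap_restrict_le`). Neither Rademacher's theorem nor a normal field is needed.
-/

namespace MultiTrace

noncomputable section

/-- The pullback of functionals along a quotient map is isometric for the quotient norm. -/
lemma norm_comp_mkQL {𝕜 E : Type*} [RCLike 𝕜] [NormedAddCommGroup E] [NormedSpace 𝕜 E]
    (S : Submodule 𝕜 E) (p : StrongDual 𝕜 (E ⧸ S)) : ‖p.comp S.mkQL‖ = ‖p‖ := by
  apply le_antisymm
  · refine ContinuousLinearMap.opNorm_le_bound _ (norm_nonneg _) fun w => ?_
    exact (p.le_opNorm _).trans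
      (mul_le_mul_of_nonneg_left (Submodule.Quotient.norm_mk_le _ _) (norm_nonneg _))
  · refine ContinuousLinearMap.opNorm_le_bound _ (norm_nonneg _) fun v => ?_
    refine le_of_forall_pos_le_add fun ε hε => ?_
    set P := p.comp S.mkQL
    have hpos : 0 < ‖P‖ + 1 := by positivity
    obtain ⟨w, hw, hlt⟩ := Submodule.Quotient.norm_mk_lt v (div_pos hε hpos)
    have h1 : ‖p v‖ ≤ ‖P‖ * ‖w‖ := by
      rw [← hw]; exact P.le_opNorm w
    have h2 : ‖P‖ * (ε / (‖P‖ + 1)) ≤ ε := by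
      rw [mul_div_assoc', div_le_iff₀ hpos]
      nlinarith [norm_nonneg P]
    calc ‖p v‖ ≤ ‖P‖ * ‖w‖ := h1
      _ ≤ ‖P‖ * (‖v‖ + ε / (‖P‖ + 1)) := by gcongr
      _ ≤ _ := by rw [mul_add]; gcongr

/-! ### The Hilbert space `H¹(Ω)` -/

/-- The bilinear pairing `f ↦ ∫_Ω g f` with a fixed square integrable `g`, as a continuous linear
functional on `L²(Ω)`. -/
def pairing {d : ℕ} {Ω : Set (Space d)} (g : Space d → ℂ) (hg : MemLp g 2 (volume.restrict Ω)) :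
    L2 Ω →L[ℂ] ℂ :=
  innerSL ℂ (hg.star.toLp (star g))

lemma L2_inner_eq {d : ℕ} {Ω : Set (Space d)} (f g : L2 Ω) :
    inner ℂ f g = ∫ x in Ω, star (f x) * g x := by
  rw [L2.inner_def]
  congr 1
  ext x
  simp [mul_comm]

lemma pairing_apply {d : ℕ} {Ω : Set (Space d)} (g : Space d → ℂ)
    (hg : MemLp g 2 (volume.restrict Ω)) (f : L2 Ω) :
    pairing g hg f = ∫ x in Ω, g x * f x := by
  rw [pairing, innerSL_apply_apply, L2_inner_eq]
  refine integral_congr_ae ?_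
  filter_upwards [hg.star.coeFn_toLp] with x hx
  rw [hx]
  simp

/-- The Hermitian product of `H¹(Ω)` as a Hilbert space, in front of the products that instance
search would find along other paths. -/
instance instInnerH1 {d : ℕ} {γ : ℝ} {Ω : Set (Space d)} : Inner ℂ (H1 γ Ω) :=
  InnerProductSpace.toInner

variable {d : ℕ} {γ : ℝ} {Ω : Set (Space d)}

/-- `v ↦ v` as a continuous linear map `H¹(Ω) → L²(Ω)`. -/
def fnOfL (γ : ℝ) (Ω : Set (Space d)) : H1 γ Ω →L[ℂ] L2 Ω :=
  (γ : ℂ) • (PiLp.proj 2 (fun _ : Option (Fin d) => L2 Ω) none).comp (H1 γ Ω).subtypeL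

/-- `v ↦ ∂_i v` as a continuous linear map `H¹(Ω) → L²(Ω)`. -/
def gradOfL (γ : ℝ) (Ω : Set (Space d)) (i : Fin d) : H1 γ Ω →L[ℂ] L2 Ω :=
  (PiLp.proj 2 (fun _ : Option (Fin d) => L2 Ω) (some i)).comp (H1 γ Ω).subtypeL

@[simp] lemma fnOfL_apply (w : H1 γ Ω) : fnOfL γ Ω w = fnOf w := rfl

@[simp] lemma gradOfL_apply (w : H1 γ Ω) (i : Fin d) : gradOfL γ Ω i w = gradOf w i := rfl

lemma hasWeakDeriv_gradOf (w : H1 γ Ω) (i : Fin d) : HasWeakDeriv Ω i (fnOf w) (gradOf w i) :=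
  w.2 i

/-- The weak derivative condition is an intersection of kernels of continuous functionals. -/
lemma isClosed_H1 : IsClosed (H1 γ Ω : Set (Jet Ω)) := by
  have : (H1 γ Ω : Set (Jet Ω)) = ⋂ i : Fin d, ⋂ φ : {φ : Space d → ℂ // IsTest Ω φ},
      {w | pairing (pderiv i φ.1) (φ.2.smooth.memLp_pderiv Ω i) ((γ : ℂ) • w none) +
        pairing φ.1 (φ.2.smooth.memLp Ω) (w (some i)) = 0} := by
    ext w
    simp only [mem_iInter, mem_ofPred_eq, pairing_apply, Subtype.forall]
    refine forall_congr' fun i => forall₂_congr fun φ _ => ?_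
    rw [← eq_neg_iff_add_eq_zero]
    simp only [mul_comm (φ _), mul_comm (pderiv i φ _)]
  rw [this]
  refine isClosed_iInter fun i => isClosed_iInter fun φ => ?_
  refine isClosed_eq ?_ continuous_const
  fun_prop

instance : CompleteSpace (H1 γ Ω) := isClosed_H1.completeSpace_coe

/-- The Hermitian product `⟨conj a, b⟩` of `H¹(Ω)` is the bilinear form of `-Δ + γ⁻²`. -/
lemma inner_conjH1 (hγ : 0 < γ) (a b : H1 γ Ω) :
    inner ℂ (conjH1 a) b =
      ∫ x in Ω, ((∑ i, gradOf a i x * gradOf b i x) + (γ : ℂ)⁻¹ ^ 2 * fnOf a x * fnOf b x) := by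
  have h1 : inner ℂ (conjH1 a) b = ∑ k, inner ℂ (star (a.1 k)) (b.1 k) := rfl
  have h2 : ∀ k, inner ℂ (star (a.1 k)) (b.1 k) = ∫ x in Ω, a.1 k x * b.1 k x := by
    intro k
    rw [L2_inner_eq]
    refine integral_congr_ae ?_
    filter_upwards [Lp.coeFn_star (a.1 k)] with x hx
    rw [hx]; simp
  have hI : ∀ k, Integrable (fun x => a.1 k x * b.1 k x) (volume.restrict Ω) := fun k =>
    integrable_mul_of_memLp (Lp.memLp _) (Lp.memLp _)
  rw [h1]
  simp_rw [h2]
  rw [← integral_finsetSum _ fun k _ => hI k]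
  refine integral_congr_ae ?_
  filter_upwards [Lp.coeFn_smul (γ : ℂ) (a.1 none), Lp.coeFn_smul (γ : ℂ) (b.1 none)]
    with x hx1 hx2
  have e1 : fnOf a x = γ * a.1 none x := hx1
  have e2 : fnOf b x = γ * b.1 none x := hx2
  have hγ' : (γ : ℂ) ≠ 0 := by exact_mod_cast hγ.ne'
  rw [Fintype.sum_option, add_comm, e1, e2]
  congr 1
  field_simp

@[simp] lemma conjH1_conjH1 (a : H1 γ Ω) : conjH1 (conjH1 a) = a := by
  apply Subtype.ext
  ext1 k
  exact star_star (a.1 k)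

lemma conjH1_add (a b : H1 γ Ω) : conjH1 (a + b) = conjH1 a + conjH1 b := by
  apply Subtype.ext
  ext1 k
  apply Lp.ext
  change (star (a.1 k + b.1 k) : L2 Ω) =ᵐ[volume.restrict Ω]
    (star (a.1 k) + star (b.1 k) : L2 Ω)
  filter_upwards [Lp.coeFn_star (a.1 k + b.1 k), Lp.coeFn_add (a.1 k) (b.1 k),
    Lp.coeFn_add (star (a.1 k)) (star (b.1 k)), Lp.coeFn_star (a.1 k),
    Lp.coeFn_star (b.1 k)] with x h1 h2 h3 h4 h5
  rw [h1, h3, Pi.star_apply, h2, Pi.add_apply, Pi.add_apply, h4, h5, star_add]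
  rfl

lemma conjH1_smul (c : ℂ) (a : H1 γ Ω) : conjH1 (c • a) = star c • conjH1 a := by
  apply Subtype.ext
  ext1 k
  apply Lp.ext
  change (star (c • a.1 k) : L2 Ω) =ᵐ[volume.restrict Ω] (star c • star (a.1 k) : L2 Ω)
  filter_upwards [Lp.coeFn_star (c • a.1 k), Lp.coeFn_smul c (a.1 k),
    Lp.coeFn_smul (star c) (star (a.1 k)), Lp.coeFn_star (a.1 k)] with x h1 h2 h3 h4
  rw [h1, h3, Pi.star_apply, h2, Pi.smul_apply, Pi.smul_apply, h4, star_smul]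
  rfl

lemma inner_conjH1_conjH1 (a b : H1 γ Ω) : inner ℂ (conjH1 a) (conjH1 b) = inner ℂ b a := by
  have h : ∀ a b : H1 γ Ω, inner ℂ a b = ∑ k, inner ℂ (a.1 k) (b.1 k) := fun _ _ => rfl
  rw [h, h]
  refine Finset.sum_congr rfl fun k _ => ?_
  rw [L2_inner_eq, L2_inner_eq]
  refine integral_congr_ae ?_
  filter_upwards [Lp.coeFn_star (a.1 k), Lp.coeFn_star (b.1 k)] with x h1 h2
  change star ((star (a.1 k) : L2 Ω) x) * (star (b.1 k) : L2 Ω) x = _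
  rw [h1, h2]
  simp [mul_comm]

lemma norm_conjH1 (a : H1 γ Ω) : ‖conjH1 a‖ = ‖a‖ := by
  have := inner_conjH1_conjH1 a a
  rw [inner_self_eq_norm_sq_to_K, inner_self_eq_norm_sq_to_K] at this
  have h2 : ‖conjH1 a‖ ^ 2 = ‖a‖ ^ 2 := by exact_mod_cast this
  exact (sq_eq_sq₀ (norm_nonneg _) (norm_nonneg _)).1 h2

lemma trace_conjH1 (a : H1 γ Ω) : conjDir (trace a) = trace (conjH1 a) := rfl

lemma isClosed_traceZero : IsClosed (traceZero γ Ω : Set (H1 γ Ω)) := by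
  have h : IsClosed (traceGraph γ Ω : Set (H1 γ Ω × Lp ℂ 2 (surface Ω))) :=
    Submodule.isClosed_topologicalClosure _
  exact h.preimage (continuous_id.prodMk continuous_const)

lemma trace_eq_zero {w : H1 γ Ω} : trace w = 0 ↔ w ∈ traceZero γ Ω :=
  Submodule.Quotient.mk_eq_zero _

lemma trace_surjective : Function.Surjective (trace : H1 γ Ω →ₗ[ℂ] DirTrace γ Ω) :=
  Submodule.mkQ_surjective _

/-! ### Riesz representatives of Neumann traces -/

/-- The functional `w ↦ ⟨p, w|_∂Ω⟩` on `H¹(Ω)`. -/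
def pullback (p : NeuTrace γ Ω) : StrongDual ℂ (H1 γ Ω) := p.comp (traceZero γ Ω).mkQL

lemma pullback_apply (p : NeuTrace γ Ω) (w : H1 γ Ω) : pullback p w = p (trace w) := rfl

lemma norm_pullback (p : NeuTrace γ Ω) : ‖pullback p‖ = ‖p‖ :=
  norm_comp_mkQL (traceZero γ Ω) p

/-- The solution `φ ∈ H¹(Ω)` of the Neumann problem `-Δφ + γ⁻² φ = 0`, `n · ∇φ = p`: the conjugate
of the Riesz representative of `w ↦ ⟨p, w|_∂Ω⟩`. -/
def neumannSol (p : NeuTrace γ Ω) : H1 γ Ω :=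
  conjH1 ((InnerProductSpace.toDual ℂ (H1 γ Ω)).symm (pullback p))

lemma inner_neumannSol (p : NeuTrace γ Ω) (w : H1 γ Ω) :
    inner ℂ (conjH1 (neumannSol p)) w = p (trace w) := by
  rw [neumannSol, conjH1_conjH1, InnerProductSpace.toDual_symm_apply, pullback_apply]

lemma eq_neumannSol {p : NeuTrace γ Ω} {φ : H1 γ Ω}
    (h : ∀ w, p (trace w) = inner ℂ (conjH1 φ) w) : φ = neumannSol p := by
  have : conjH1 φ = conjH1 (neumannSol p) :=
    ext_inner_right ℂ fun w => by rw [inner_neumannSol, h]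
  rw [← conjH1_conjH1 φ, this, conjH1_conjH1]

lemma norm_neumannSol (p : NeuTrace γ Ω) : ‖neumannSol p‖ = ‖p‖ := by
  rw [neumannSol, norm_conjH1, LinearIsometryEquiv.norm_map, norm_pullback]

lemma neumannSol_add (p q : NeuTrace γ Ω) :
    neumannSol (p + q) = neumannSol p + neumannSol q := by
  refine (eq_neumannSol fun w => ?_).symm
  rw [conjH1_add, inner_add_left, inner_neumannSol, inner_neumannSol, _root_.add_apply]

lemma neumannSol_smul (c : ℂ) (p : NeuTrace γ Ω) :
    neumannSol (c • p) = c • neumannSol p := by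
  refine (eq_neumannSol fun w => ?_).symm
  rw [conjH1_smul]
  refine Eq.trans ?_ (inner_smul_left (𝕜 := ℂ) (conjH1 (neumannSol p)) w (star c)).symm
  rw [inner_neumannSol]
  simp

/-- A function orthogonal to `{w : w|_∂Ω = 0}` solves the Neumann problem for some datum. -/
lemma exists_neumannSol_eq {φ : H1 γ Ω} (h : ∀ w ∈ traceZero γ Ω, inner ℂ (conjH1 φ) w = 0) :
    ∃ p : NeuTrace γ Ω, neumannSol p = φ := by
  let p : NeuTrace γ Ω := (traceZero γ Ω).liftQL (innerSL ℂ (conjH1 φ)) h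
  exact ⟨p, (eq_neumannSol fun w => rfl).symm⟩

/-- The Neumann-to-Dirichlet map `p ↦ φ|_∂Ω`, with `φ` the solution of the Neumann problem. -/
def ntd (γ : ℝ) (Ω : Set (Space d)) : NeuTrace γ Ω →ₗ[ℂ] DirTrace γ Ω where
  toFun p := trace (neumannSol p)
  map_add' p q := by rw [neumannSol_add, map_add]
  map_smul' c p := by rw [neumannSol_smul, map_smul]; rfl

lemma ntd_apply (p : NeuTrace γ Ω) : ntd γ Ω p = trace (neumannSol p) := rfl

lemma ntd_injective : Function.Injective (ntd γ Ω) := by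
  rw [← LinearMap.ker_eq_bot, LinearMap.ker_eq_bot']
  intro p hp
  have h0 : inner ℂ (conjH1 (neumannSol p)) (conjH1 (neumannSol p)) = 0 := by
    rw [inner_neumannSol, trace_eq_zero.2 (conjH1_mem_traceZero (trace_eq_zero.1 hp)), map_zero]
  rw [inner_self_eq_zero] at h0
  ext v
  obtain ⟨w, rfl⟩ := trace_surjective v
  rw [← inner_neumannSol, h0, inner_zero_left]
  rfl

lemma ntd_surjective : Function.Surjective (ntd γ Ω) := by
  intro v
  obtain ⟨w, rfl⟩ := trace_surjective v
  have : CompleteSpace (traceZero γ Ω) := isClosed_traceZero.completeSpace_coe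
  obtain ⟨y, hy, z, hz, rfl⟩ := (traceZero γ Ω).exists_add_mem_mem_orthogonal w
  have hz' : ∀ u ∈ traceZero γ Ω, inner ℂ (conjH1 z) u = 0 := by
    intro u hu
    have := hz (conjH1 u) (conjH1_mem_traceZero hu)
    rw [← conjH1_conjH1 u, inner_conjH1_conjH1]
    simpa using this
  obtain ⟨p, hp⟩ := exists_neumannSol_eq hz'
  exact ⟨p, by rw [ntd_apply, hp, map_add, trace_eq_zero.2 hy, zero_add]⟩

end

noncomputable section

variable {d : ℕ} {γ : ℝ} {Ω : Set (Space d)}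

/-! ### Weak derivatives of smooth functions -/

lemma IsSmoothComp.mul {φ χ : Space d → ℂ} (hφ : ContDiff ℝ ∞ φ) (hχ : IsSmoothComp χ) :
    IsSmoothComp (fun x => φ x * χ x) :=
  ⟨hφ.mul hχ.1, hχ.2.mul_left⟩

lemma tsupport_pderiv_subset (φ : Space d → ℂ) (i : Fin d) :
    tsupport (pderiv i φ) ⊆ tsupport φ :=
  tsupport_fderiv_apply_subset ℝ _

lemma IsSmoothComp.pderiv {φ : Space d → ℂ} (h : IsSmoothComp φ) (i : Fin d) :
    IsSmoothComp (pderiv i φ) :=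
  ⟨(h.1.fderiv_right (m := ∞) (by simp)).clm_apply contDiff_const, h.2.fderiv_apply (𝕜 := ℝ) _⟩

lemma pderiv_mul {φ χ : Space d → ℂ} (hφ : ContDiff ℝ ∞ φ) (hχ : ContDiff ℝ ∞ χ) (i : Fin d)
    (x : Space d) :
    pderiv i (fun x => φ x * χ x) x = φ x * pderiv i χ x + pderiv i φ x * χ x := by
  have h1 := (hφ.differentiable (by simp)) x
  have h2 := (hχ.differentiable (by simp)) x
  simp only [pderiv]
  rw [fderiv_fun_mul h1 h2]
  simp only [_root_.add_apply, _root_.smul_apply, smul_eq_mul]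
  ring

lemma HasWeakDeriv.of_smooth {v : Space d → ℂ} (hv : IsSmoothComp v)
    (i : Fin d) : HasWeakDeriv Ω i v (pderiv i v) := by
  intro φ hφ
  have e1 : ∫ x in Ω, v x * pderiv i φ x = ∫ x, v x * pderiv i φ x := by
    refine setIntegral_eq_integral_of_forall_compl_eq_zero fun x hx => ?_
    have : x ∉ tsupport (pderiv i φ) := fun h => hx (hφ.2.2 (tsupport_pderiv_subset φ i h))
    rw [image_eq_zero_of_notMem_tsupport this, mul_zero]
  have e2 : ∫ x in Ω, pderiv i v x * φ x = ∫ x, pderiv i v x * φ x := by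
    refine setIntegral_eq_integral_of_forall_compl_eq_zero fun x hx => ?_
    have : x ∉ tsupport φ := fun h => hx (hφ.2.2 h)
    rw [image_eq_zero_of_notMem_tsupport this, mul_zero]
  have hI : ∀ {f g : Space d → ℂ}, IsSmoothComp f → IsSmoothComp g →
      Integrable (fun x => f x * g x) := fun hf hg => by
    have := integrable_mul_of_memLp (hf.memLp univ) (hg.memLp univ)
    rwa [Measure.restrict_univ] at this
  rw [e1, e2]
  exact integral_mul_fderiv_eq_neg_fderiv_mul_of_integrable (hI (hv.pderiv i) hφ.smooth)
    (hI hv (hφ.smooth.pderiv i)) (hI hv hφ.smooth)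
    (fun x _ => (hv.1.differentiable (by simp)) x) (fun x _ => (hφ.1.differentiable (by simp)) x)

lemma IsTest.of_real {g : Space d → ℝ} (h1 : ContDiff ℝ ∞ g) (h2 : HasCompactSupport g)
    (h3 : tsupport g ⊆ Ω) : IsTest Ω (fun x => (g x : ℂ)) := by
  refine ⟨Complex.ofRealCLM.contDiff.comp h1, h2.comp_left (g := fun t : ℝ => (t : ℂ)) (by simp),
    (closure_mono fun x hx => ?_).trans h3⟩
  contrapose! hx
  simp only [Function.notMem_support] at hx ⊢
  simp [hx]

/-- The weak derivative of a function on an open set is unique. -/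
lemma HasWeakDeriv.unique (hΩ : IsOpen Ω) {i : Fin d} {v g g' : Space d → ℂ}
    (hg : MemLp g 2 (volume.restrict Ω)) (hg' : MemLp g' 2 (volume.restrict Ω))
    (h : HasWeakDeriv Ω i v g) (h' : HasWeakDeriv Ω i v g') : g =ᵐ[volume.restrict Ω] g' := by
  have hl : LocallyIntegrableOn (fun x => g x - g' x) Ω := by
    rw [locallyIntegrableOn_iff hΩ.isLocallyClosed]
    intro k hk hkc
    have hm : MemLp (fun x => g x - g' x) 2 (volume.restrict k) :=
      (hg.sub hg').mono_measure (Measure.restrict_mono hk le_rfl)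
    have : IsFiniteMeasure (volume.restrict k) := ⟨by simpa using hkc.measure_lt_top⟩
    exact hm.integrable (by norm_num)
  have := hΩ.ae_eq_zero_of_integral_contDiff_smul_eq_zero hl (fun χ h1 h2 h3 => by
    have ht := IsTest.of_real h1 h2 h3
    have e := (h _ ht).symm.trans (h' _ ht)
    rw [neg_inj] at e
    have e1 : ∫ x, χ x • (g x - g' x) = ∫ x in Ω, χ x • (g x - g' x) := by
      refine (setIntegral_eq_integral_of_forall_compl_eq_zero fun x hx => ?_).symm
      rw [image_eq_zero_of_notMem_tsupport fun hh => hx (h3 hh), zero_smul]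
    rw [e1]
    have e2 : ∀ x, χ x • (g x - g' x) = g x * (χ x : ℂ) - g' x * (χ x : ℂ) := fun x => by
      rw [Complex.real_smul]; ring
    simp_rw [e2]
    rw [integral_sub (integrable_mul_of_memLp hg (ht.smooth.memLp Ω))
      (integrable_mul_of_memLp hg' (ht.smooth.memLp Ω)), e, sub_self])
  filter_upwards [(ae_restrict_iff' hΩ.measurableSet).2 this] with x hx
  exact sub_eq_zero.1 hx

lemma gradOf_ae_eq (hΩ : IsOpen Ω) (w : H1 γ Ω) {v : Space d → ℂ} {i : Fin d} {g : Space d → ℂ}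
    (hw : fnOf w =ᵐ[volume.restrict Ω] v) (hg : MemLp g 2 (volume.restrict Ω))
    (h : HasWeakDeriv Ω i v g) : gradOf w i =ᵐ[volume.restrict Ω] g :=
  ((hasWeakDeriv_gradOf w i).congr hw Filter.EventuallyEq.rfl).unique hΩ (Lp.memLp _) hg h

lemma exists_H1 (hγ : 0 < γ) {v : Space d → ℂ} {g : Fin d → Space d → ℂ}
    (hv : MemLp v 2 (volume.restrict Ω)) (hg : ∀ i, MemLp (g i) 2 (volume.restrict Ω))
    (h : ∀ i, HasWeakDeriv Ω i v (g i)) :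
    ∃ w : H1 γ Ω, fnOf w =ᵐ[volume.restrict Ω] v ∧
      ∀ i, gradOf w i =ᵐ[volume.restrict Ω] g i := by
  have hγ' : (γ : ℂ) ≠ 0 := by exact_mod_cast hγ.ne'
  let a : Jet Ω := WithLp.toLp 2 (fun k => match k with
    | none => (γ : ℂ)⁻¹ • hv.toLp v
    | some i => (hg i).toLp (g i))
  have e : (γ : ℂ) • a none = hv.toLp v := by
    change (γ : ℂ) • (γ : ℂ)⁻¹ • hv.toLp v = _
    rw [smul_smul, mul_inv_cancel₀ hγ', one_smul]
  have ha : a ∈ H1 γ Ω := fun i => by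
    refine (h i).congr ?_ (hg i).coeFn_toLp.symm
    rw [e]
    exact hv.coeFn_toLp.symm
  refine ⟨⟨a, ha⟩, ?_, fun i => (hg i).coeFn_toLp⟩
  rw [show fnOf (⟨a, ha⟩ : H1 γ Ω) = hv.toLp v from e]
  exact hv.coeFn_toLp

lemma exists_H1_of_smooth (hγ : 0 < γ) {φ : Space d → ℂ} (hφ : IsSmoothComp φ) :
    ∃ w : H1 γ Ω, fnOf w =ᵐ[volume.restrict Ω] φ ∧
      ∀ i, gradOf w i =ᵐ[volume.restrict Ω] pderiv i φ :=
  exists_H1 hγ (hφ.memLp Ω) (hφ.memLp_pderiv Ω) (HasWeakDeriv.of_smooth hφ)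

/-- Two elements of `H¹(Ω)` with the same underlying function are equal. -/
lemma H1_ext (hγ : 0 < γ) (hΩ : IsOpen Ω) {w z : H1 γ Ω}
    (h : fnOf w =ᵐ[volume.restrict Ω] fnOf z) : w = z := by
  have hγ' : (γ : ℂ) ≠ 0 := by exact_mod_cast hγ.ne'
  apply Subtype.ext
  ext1 k
  cases k with
  | none => exact smul_right_injective _ hγ' (Lp.ext h)
  | some i => exact Lp.ext (gradOf_ae_eq hΩ w h (Lp.memLp _) (hasWeakDeriv_gradOf z i))

/-- Test functions on `Ω` have trace zero. -/
lemma mem_traceZero_of_isTest (hΩ : IsOpen Ω) {φ : Space d → ℂ} (hφ : IsTest Ω φ)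
    {w : H1 γ Ω} (hw : fnOf w =ᵐ[volume.restrict Ω] φ) : w ∈ traceZero γ Ω := by
  refine Submodule.le_topologicalClosure _ ⟨φ, hφ.smooth, hw, ?_⟩
  refine (Lp.coeFn_zero _ _ _).trans ?_
  rw [surface]
  filter_upwards [ae_restrict_mem isClosed_frontier.measurableSet] with x hx
  have : x ∉ tsupport φ := fun h => by
    rw [hΩ.frontier_eq] at hx
    exact hx.2 (hφ.2.2 h)
  rw [image_eq_zero_of_notMem_tsupport this]
  rfl

/-! ### The Dirichlet-to-Neumann map -/

lemma isNormalTrace_neumannSol (hγ : 0 < γ) (p : NeuTrace γ Ω) :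
    IsNormalTrace γ Ω (fun i => gradOf (neumannSol p) i)
      (fun x => (γ : ℂ)⁻¹ ^ 2 * fnOf (neumannSol p) x) p := fun w => by
  rw [← inner_neumannSol, inner_conjH1 hγ]

/-- Green's formula on `H¹(Ω)` contains the equation in `Ω`: test functions have trace zero. -/
lemma hasWeakDiv_neumannSol (hγ : 0 < γ) (hΩ : IsOpen Ω) (p : NeuTrace γ Ω) :
    HasWeakDiv Ω (fun i => gradOf (neumannSol p) i)
      (fun x => (γ : ℂ)⁻¹ ^ 2 * fnOf (neumannSol p) x) := by
  intro χ hχ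
  obtain ⟨w, hw, hw'⟩ := exists_H1_of_smooth hγ hχ.smooth
  have h0 := isNormalTrace_neumannSol hγ p w
  rw [trace_eq_zero.2 (mem_traceZero_of_isTest hΩ hχ hw), map_zero] at h0
  rw [← add_eq_zero_iff_eq_neg, ← integral_add]
  · rw [h0]
    refine integral_congr_ae ?_
    filter_upwards [hw, ae_all_iff.2 hw'] with x h1 h2
    simp only [h1, h2]
  · exact integrable_finsetSum _ fun i _ =>
      integrable_mul_of_memLp (Lp.memLp _) (hχ.smooth.memLp_pderiv Ω i)
  · exact integrable_mul_of_memLp ((Lp.memLp _).const_mul _) (hχ.smooth.memLp Ω)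

/-- The Dirichlet-to-Neumann relation is the inverse of the graph of `ntd`. -/
lemma isDtN_iff (hγ : 0 < γ) (hΩ : IsOpen Ω) {v : DirTrace γ Ω} {p : NeuTrace γ Ω} :
    IsDtN γ Ω v p ↔ ntd γ Ω p = v := by
  constructor
  · rintro ⟨φ, rfl, -, h⟩
    rw [ntd_apply, eq_neumannSol (p := p) (φ := φ) fun w => by rw [h w, inner_conjH1 hγ]]
  · rintro rfl
    exact ⟨neumannSol p, rfl, hasWeakDiv_neumannSol hγ hΩ p, isNormalTrace_neumannSol hγ p⟩

section Multi

variable {J : ℕ} {Ω : Fin (J + 1) → Set (Space d)}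

/-- The block diagonal Neumann-to-Dirichlet map on `ℍ_N(Γ)`. -/
def multiNtd (γ : ℝ) (Ω : Fin (J + 1) → Set (Space d)) : MultiNeu γ Ω ≃ₗ[ℂ] MultiDir γ Ω :=
  (WithLp.linearEquiv 2 ℂ (∀ j, NeuTrace γ (Ω j))).trans
    ((LinearEquiv.piCongrRight fun j =>
      LinearEquiv.ofBijective (ntd γ (Ω j)) ⟨ntd_injective, ntd_surjective⟩).trans
    (WithLp.linearEquiv 2 ℂ (∀ j, DirTrace γ (Ω j))).symm)

lemma multiNtd_apply (p : MultiNeu γ Ω) (j : Fin (J + 1)) :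
    multiNtd γ Ω p j = trace (neumannSol (p j)) := rfl

lemma neuInner_eq (p q : MultiNeu γ Ω) :
    neuInner (multiNtd γ Ω) p q =
      ∑ j, inner ℂ (neumannSol (q j)) (neumannSol (p j)) := by
  refine Finset.sum_congr rfl fun j _ => ?_
  rw [multiNtd_apply, trace_conjH1, ← inner_neumannSol, inner_conjH1_conjH1]
  exact inner_conj_symm _ _

lemma neuInner_conj_symm (p q : MultiNeu γ Ω) :
    neuInner (multiNtd γ Ω) q p = (starRingEnd ℂ) (neuInner (multiNtd γ Ω) p q) := by
  rw [neuInner_eq, neuInner_eq, map_sum]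
  exact Finset.sum_congr rfl fun j _ => (inner_conj_symm _ _).symm

lemma norm_sq_multiNeu (p : MultiNeu γ Ω) : ‖p‖ ^ 2 = ∑ j, ‖neumannSol (p j)‖ ^ 2 := by
  simp_rw [norm_neumannSol]
  exact PiLp.norm_sq_eq_of_L2 _ p

lemma neuInner_self (p : MultiNeu γ Ω) :
    neuInner (multiNtd γ Ω) p p = ((‖p‖ ^ 2 : ℝ) : ℂ) := by
  rw [neuInner_eq, norm_sq_multiNeu, Complex.ofReal_sum]
  refine Finset.sum_congr rfl fun j _ => ?_
  rw [inner_self_eq_norm_sq_to_K]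
  simp

lemma eq_zero_of_neuInner_self {p : MultiNeu γ Ω} (h : neuInner (multiNtd γ Ω) p p = 0) :
    p = 0 := by
  rw [neuInner_self, Complex.ofReal_eq_zero, norm_sq_multiNeu] at h
  ext1 j
  have h3 := (Finset.sum_eq_zero_iff_of_nonneg fun j _ => sq_nonneg _).1 h j (Finset.mem_univ j)
  have h4 : neumannSol (p j) = 0 := norm_eq_zero.1 (pow_eq_zero_iff two_ne_zero |>.1 h3)
  refine ntd_injective (γ := γ) (Ω := Ω j) ?_
  rw [ntd_apply, h4]
  exact (map_zero _).trans (map_zero _).symm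

end Multi

/-! ### Restriction to a subdomain -/

/-- Restriction of square integrable functions from `ℝ^d` to `Ω`. -/
def resL2 (Ω : Set (Space d)) (f : L2 (univ : Set (Space d))) : L2 Ω :=
  ((Lp.memLp f).mono_measure (Measure.restrict_mono (subset_univ Ω) le_rfl)).toLp f

lemma coeFn_resL2 (Ω : Set (Space d)) (f : L2 (univ : Set (Space d))) :
    resL2 Ω f =ᵐ[volume.restrict Ω] f := MemLp.coeFn_toLp _

lemma HasWeakDeriv.restrict {i : Fin d} {v g : Space d → ℂ} (h : HasWeakDeriv univ i v g) :
    HasWeakDeriv Ω i v g := by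
  intro φ hφ
  have h1 := h φ ⟨hφ.1, hφ.2.1, subset_univ _⟩
  rw [setIntegral_univ, setIntegral_univ] at h1
  have e1 : ∫ x in Ω, v x * pderiv i φ x = ∫ x, v x * pderiv i φ x := by
    refine setIntegral_eq_integral_of_forall_compl_eq_zero fun x hx => ?_
    have : x ∉ tsupport (pderiv i φ) := fun h => hx (hφ.2.2 (tsupport_pderiv_subset φ i h))
    rw [image_eq_zero_of_notMem_tsupport this, mul_zero]
  have e2 : ∫ x in Ω, g x * φ x = ∫ x, g x * φ x := by
    refine setIntegral_eq_integral_of_forall_compl_eq_zero fun x hx => ?_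
    have : x ∉ tsupport φ := fun h => hx (hφ.2.2 h)
    rw [image_eq_zero_of_notMem_tsupport this, mul_zero]
  rw [e1, e2, h1]

lemma resL2_add (f g : L2 (univ : Set (Space d))) :
    resL2 Ω (f + g) = resL2 Ω f + resL2 Ω g := by
  apply Lp.ext
  filter_upwards [coeFn_resL2 Ω (f + g), coeFn_resL2 Ω f, coeFn_resL2 Ω g,
    Lp.coeFn_add (resL2 Ω f) (resL2 Ω g), ae_eq_of_univ (Ω := Ω) (Lp.coeFn_add f g)]
    with x h1 h2 h3 h4 h5
  rw [h1, h4, h5, Pi.add_apply, Pi.add_apply, h2, h3]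

lemma resL2_smul (c : ℂ) (f : L2 (univ : Set (Space d))) :
    resL2 Ω (c • f) = c • resL2 Ω f := by
  apply Lp.ext
  filter_upwards [coeFn_resL2 Ω (c • f), coeFn_resL2 Ω f,
    Lp.coeFn_smul c (resL2 Ω f), ae_eq_of_univ (Ω := Ω) (Lp.coeFn_smul c f)]
    with x h1 h2 h4 h5
  rw [h1, h4, h5, Pi.smul_apply, Pi.smul_apply, h2]

lemma norm_resL2_le (f : L2 (univ : Set (Space d))) : ‖resL2 Ω f‖ ≤ ‖f‖ := by
  rw [resL2, Lp.norm_toLp, Lp.norm_def]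
  exact ENNReal.toReal_mono (Lp.eLpNorm_ne_top f)
    (eLpNorm_mono_measure _ (Measure.restrict_mono (subset_univ Ω) le_rfl))

lemma norm_sq_H1 (w : H1 γ Ω) : ‖w‖ ^ 2 = ∑ k, ‖w.1 k‖ ^ 2 := PiLp.norm_sq_eq_of_L2 _ w.1

/-- Restriction `H¹(ℝ^d) → H¹(Ω)` as a linear map. -/
def resH1Lin (γ : ℝ) (Ω : Set (Space d)) : H1 γ (univ : Set (Space d)) →ₗ[ℂ] H1 γ Ω where
  toFun w := ⟨WithLp.toLp 2 (fun k => resL2 Ω (w.1 k)), fun i => by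
    refine (w.2 i).restrict.congr ?_ (coeFn_resL2 Ω _).symm
    change _ =ᵐ[_] ((γ : ℂ) • resL2 Ω (w.1 none) : L2 Ω)
    rw [← resL2_smul]
    exact (coeFn_resL2 Ω _).symm⟩
  map_add' a b := by
    apply Subtype.ext
    ext1 k
    exact resL2_add (a.1 k) (b.1 k)
  map_smul' c a := by
    apply Subtype.ext
    ext1 k
    exact resL2_smul c (a.1 k)

lemma norm_resH1Lin_le (w : H1 γ (univ : Set (Space d))) : ‖resH1Lin γ Ω w‖ ≤ 1 * ‖w‖ := by
  rw [one_mul]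
  refine (sq_le_sq₀ (norm_nonneg _) (norm_nonneg _)).1 ?_
  rw [norm_sq_H1, norm_sq_H1]
  exact Finset.sum_le_sum fun k _ => pow_le_pow_left₀ (norm_nonneg _) (norm_resL2_le _) 2

/-- Restriction `H¹(ℝ^d) → H¹(Ω)` as a continuous linear map. -/
def resH1 (γ : ℝ) (Ω : Set (Space d)) : H1 γ (univ : Set (Space d)) →L[ℂ] H1 γ Ω :=
  LinearMap.mkContinuous (resH1Lin γ Ω) 1 norm_resH1Lin_le

lemma gradOf_resH1 (w : H1 γ (univ : Set (Space d))) (i : Fin d) :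
    gradOf (resH1 γ Ω w) i =ᵐ[volume.restrict Ω] gradOf w i := coeFn_resL2 Ω _

lemma fnOf_resH1 (w : H1 γ (univ : Set (Space d))) :
    fnOf (resH1 γ Ω w) =ᵐ[volume.restrict Ω] fnOf w := by
  have : fnOf (resH1 γ Ω w) = resL2 Ω (fnOf w) := (resL2_smul (γ : ℂ) (w.1 none)).symm
  rw [this]
  exact coeFn_resL2 Ω _

lemma mem_singleDir_iff (hγ : 0 < γ) {J : ℕ} {Ω : Fin (J + 1) → Set (Space d)}
    (hΩ : ∀ j, IsOpen (Ω j)) {v : MultiDir γ Ω} :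
    v ∈ singleDir γ Ω ↔ ∃ φ : H1 γ (univ : Set (Space d)), ∀ j, v j = trace (resH1 γ (Ω j) φ) := by
  constructor
  · rintro ⟨φ, hφ⟩
    refine ⟨φ, fun j => ?_⟩
    obtain ⟨w, h1, h2⟩ := hφ j
    rw [h2, H1_ext hγ (hΩ j) (h1.trans (fnOf_resH1 φ).symm)]
  · rintro ⟨φ, hφ⟩
    exact ⟨φ, fun j => ⟨_, fnOf_resH1 φ, hφ j⟩⟩

end

noncomputable section

variable {d : ℕ}

/-! ### Green's formula on the whole space -/

lemma memLp_of_restrict_univ {f : Space d → ℂ} (h : MemLp f 2 (volume.restrict univ)) :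
    MemLp f 2 := by
  rwa [Measure.restrict_univ] at h

lemma MemLp.comp_sub_right {u : Space d → ℂ} (hu : MemLp u 2) (y : Space d) :
    MemLp (fun x => u (x - y)) 2 :=
  hu.comp_measurePreserving (measurePreserving_sub_right volume y)

/-- Translation is continuous in `L²`, tested against a fixed square integrable function. -/
lemma continuous_integral_mul_translate {g u : Space d → ℂ} (hg : MemLp g 2) (hu : MemLp u 2) :
    Continuous (fun y : Space d => ∫ x, g x * u (x - y)) := by
  have hmp : ∀ y : Space d, MeasurePreserving (fun x : Space d => x - y) volume volume :=
    measurePreserving_sub_right volume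
  let τ : C(Space d, C(Space d, Space d)) :=
    (ContinuousMap.mk (fun a : Space d × Space d => a.2 - a.1) (by fun_prop)).curry
  have hc : Continuous (fun y : Space d =>
      Lp.compMeasurePreserving (τ y) (hmp y) (hu.toLp u)) :=
    continuous_const.compMeasurePreservingLp τ.continuous hmp (by simp)
  have hcc := (continuous_const (y := hg.star.toLp (star g))).inner (𝕜 := ℂ) hc
  refine hcc.congr fun y => ?_
  rw [L2.inner_def]
  refine integral_congr_ae ?_
  have h2 : (fun x => (hu.toLp u) (x - y)) =ᵐ[volume] fun x => u (x - y) :=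
    (hmp y).quasiMeasurePreserving.ae_eq_comp hu.coeFn_toLp
  filter_upwards [hg.star.coeFn_toLp,
    Lp.coeFn_compMeasurePreserving (hu.toLp u) (hmp y), h2] with x h1 h3 h4
  rw [h1]
  have h5 : (Lp.compMeasurePreserving (τ y) (hmp y) (hu.toLp u)) x = u (x - y) := by
    rw [← h4]; exact h3
  rw [h5]
  simp [mul_comm]

lemma integrable_mul_of_memLp_volume {f g : Space d → ℂ} (hf : MemLp f 2) (hg : MemLp g 2) :
    Integrable (fun x => f x * g x) :=
  hf.integrable_mul hg

lemma integral_mul_mollify {g u ρ : Space d → ℂ} (hg : MemLp g 2) (hu : MemLp u 2)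
    (hρ : Integrable ρ) :
    ∫ y, ρ y * ∫ x, g x * u (x - y) = ∫ x, g x * ∫ y, ρ y * u (x - y) := by
  have hm : AEStronglyMeasurable
      (fun p : Space d × Space d => g p.1 * (ρ p.2 * u (p.1 - p.2))) (volume.prod volume) :=
    hg.1.comp_fst.mul
      (hρ.1.convolution_integrand (ContinuousLinearMap.mul ℝ ℂ) hu.1)
  have hsq : Integrable (fun x => ‖g x‖ ^ 2) := (memLp_two_iff_integrable_sq_norm hg.1).1 hg
  have hsu : Integrable (fun x => ‖u x‖ ^ 2) := (memLp_two_iff_integrable_sq_norm hu.1).1 hu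
  have hI : Integrable (fun p : Space d × Space d => g p.1 * (ρ p.2 * u (p.1 - p.2)))
      (volume.prod volume) := by
    rw [integrable_prod_iff' hm]
    constructor
    · refine Filter.Eventually.of_forall fun y => ?_
      refine ((integrable_mul_of_memLp_volume hg (MemLp.comp_sub_right hu y)).const_mul
        (ρ y)).congr (Filter.Eventually.of_forall fun x => ?_)
      simp only
      ring
    · refine Integrable.mono' (hρ.norm.mul_const ((∫ x, ‖g x‖ ^ 2) + ∫ x, ‖u x‖ ^ 2))
        hm.norm.prod_swap.integral_prod_right' (Filter.Eventually.of_forall fun y => ?_)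
      rw [Real.norm_of_nonneg (integral_nonneg fun x => norm_nonneg _)]
      have e1 : ∀ x, ‖g x * (ρ y * u (x - y))‖ = ‖ρ y‖ * ‖g x * u (x - y)‖ := fun x => by
        rw [norm_mul, norm_mul, norm_mul]; ring
      simp_rw [e1]
      rw [integral_const_mul]
      refine mul_le_mul_of_nonneg_left ?_ (norm_nonneg _)
      have hsy : Integrable (fun x => ‖u (x - y)‖ ^ 2) := hsu.comp_sub_right y
      rw [← integral_sub_right_eq_self (fun x => ‖u x‖ ^ 2) y, ← integral_add hsq hsy]
      refine integral_mono
        (integrable_mul_of_memLp_volume hg (MemLp.comp_sub_right hu y)).norm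
        (hsq.add hsy) fun x => ?_
      simp only [norm_mul]
      nlinarith [sq_nonneg (‖g x‖ - ‖u (x - y)‖), norm_nonneg (g x), norm_nonneg (u (x - y))]
  have key := integral_integral_swap (f := fun x y => g x * (ρ y * u (x - y))) hI
  simp_rw [integral_const_mul] at key
  rw [key]
  refine integral_congr_ae (Filter.Eventually.of_forall fun y => ?_)
  simp only
  rw [← integral_const_mul]
  refine integral_congr_ae (Filter.Eventually.of_forall fun x => ?_)
  simp only
  ring

/-- Mollification of a compactly supported `H¹` function is a test function, and commutes with
weak derivatives. -/
lemma mollify_smooth {w : Space d → ℂ} {u : Fin d → Space d → ℂ} {ρ : Space d → ℂ}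
    (hw : MemLp w 2) (hd : ∀ i, HasWeakDeriv univ i w (u i)) (hc : HasCompactSupport w)
    (hρ : IsSmoothComp ρ) :
    IsSmoothComp (fun x => ∫ y, ρ y * w (x - y)) ∧
      ∀ i x, pderiv i (fun x => ∫ y, ρ y * w (x - y)) x = ∫ y, ρ y * u i (x - y) := by
  have hwl : LocallyIntegrable w := hw.locallyIntegrable (by norm_num)
  have e : (fun x => ∫ y, ρ y * w (x - y)) =
      MeasureTheory.convolution w ρ (ContinuousLinearMap.mul ℝ ℂ) volume := by
    ext x
    rw [convolution_def, ← integral_sub_left_eq_self _ volume x]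
    refine integral_congr_ae (Filter.Eventually.of_forall fun y => ?_)
    simp [mul_comm]
  rw [e]
  refine ⟨⟨hρ.2.contDiff_convolution_right _ hwl hρ.1, hc.convolution _ hρ.2⟩, fun i x => ?_⟩
  rw [pderiv, (hρ.2.hasFDerivAt_convolution_right _ hwl (hρ.1.of_le (by simp)) x).fderiv,
    convolution_precompR_apply _ hwl (hρ.2.fderiv ℝ) (hρ.1.continuous_fderiv (by simp)),
    convolution_def]
  have h1 : ContDiff ℝ ∞ (fun t => ρ (x - t)) := hρ.1.comp (contDiff_const.sub contDiff_id)
  have h2 : HasCompactSupport (fun t => ρ (x - t)) :=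
    hρ.2.comp_homeomorph (Homeomorph.subLeft x)
  have h3 := hd i (fun t => ρ (x - t)) ⟨h1, h2, subset_univ _⟩
  rw [setIntegral_univ, setIntegral_univ] at h3
  have h4 : ∀ t, pderiv i (fun t => ρ (x - t)) t = - pderiv i ρ (x - t) := fun t => by
    have h5 := ((hρ.1.differentiable (by simp)) (x - t)).hasFDerivAt.comp t
      ((hasFDerivAt_id t).const_sub x)
    have h6 := h5.fderiv
    simp only [Function.comp_def] at h6
    rw [pderiv, h6, pderiv]
    simp
  simp_rw [h4, mul_neg, integral_neg, neg_inj] at h3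
  rw [← integral_sub_left_eq_self (fun y => ρ y * u i (x - y)) volume x]
  refine h3.trans (integral_congr_ae (Filter.Eventually.of_forall fun y => ?_))
  simp [mul_comm]

/-- The function `y ↦ ∫ ψ(x) · ∇w(x - y) + f(x) w(x - y) dx` is continuous, and its integrals
against all test functions vanish by mollification, so that it is zero at `y = 0`. -/
lemma green_of_hasCompactSupport {ψ : Fin d → Space d → ℂ} {f : Space d → ℂ}
    (h : MemHDiv univ ψ f) {w : Space d → ℂ} {u : Fin d → Space d → ℂ} (hw : MemLp w 2)
    (hu : ∀ i, MemLp (u i) 2) (hd : ∀ i, HasWeakDeriv univ i w (u i))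
    (hc : HasCompactSupport w) : ∫ x, ((∑ i, ψ i x * u i x) + f x * w x) = 0 := by
  have hψ : ∀ i, MemLp (ψ i) 2 := fun i =>
    memLp_of_restrict_univ (h.memLp i)
  have hf : MemLp f 2 :=
    memLp_of_restrict_univ (h.memLp_div)
  let C : Space d → ℂ := fun y => (∑ i, ∫ x, ψ i x * u i (x - y)) + ∫ x, f x * w (x - y)
  have hC : Continuous C :=
    (continuous_finsetSum _ fun i _ => continuous_integral_mul_translate (hψ i) (hu i)).add
      (continuous_integral_mul_translate hf hw)
  have hC0 : ∀ᵐ y, C y = 0 := by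
    refine ae_eq_zero_of_integral_contDiff_smul_eq_zero hC.locallyIntegrable fun ρ h1 h2 => ?_
    have hρ : IsSmoothComp (fun y => (ρ y : ℂ)) := (IsTest.of_real h1 h2 (subset_univ _)).smooth
    have hρi : Integrable (fun y => (ρ y : ℂ)) :=
      hρ.1.continuous.integrable_of_hasCompactSupport hρ.2
    have hint : ∀ {g v : Space d → ℂ}, MemLp g 2 → MemLp v 2 →
        Integrable (fun y => (ρ y : ℂ) * ∫ x, g x * v (x - y)) := fun hg hv =>
      (hρ.1.continuous.mul (continuous_integral_mul_translate hg hv)).integrable_of_hasCompactSupport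
        hρ.2.mul_right
    obtain ⟨hη, hη'⟩ := mollify_smooth hw hd hc hρ
    have hdiv := h.weakDiv _ ⟨hη.1, hη.2, subset_univ _⟩
    rw [setIntegral_univ, setIntegral_univ] at hdiv
    simp_rw [hη'] at hdiv
    have hm : ∀ i, MemLp (fun x => ∫ y, (ρ y : ℂ) * u i (x - y)) 2 := fun i => by
      have := hη.memLp_pderiv univ i
      rw [Measure.restrict_univ] at this
      rwa [show pderiv i (fun x => ∫ y, (ρ y : ℂ) * w (x - y)) =
        fun x => ∫ y, (ρ y : ℂ) * u i (x - y) from funext (hη' i)] at this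
    rw [integral_finsetSum _ fun i _ => integrable_mul_of_memLp_volume (hψ i) (hm i)] at hdiv
    simp_rw [Complex.real_smul, C, mul_add, Finset.mul_sum]
    rw [integral_add (integrable_finsetSum _ fun i _ => hint (hψ i) (hu i)) (hint hf hw),
      integral_finsetSum _ fun i _ => hint (hψ i) (hu i), integral_mul_mollify hf hw hρi]
    simp_rw [integral_mul_mollify (hψ _) (hu _) hρi]
    rw [hdiv, neg_add_cancel]
  have h0 : C = 0 := (hC.ae_eq_iff_eq volume continuous_zero).1 hC0
  have h00 : C 0 = 0 := by rw [h0]; rfl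
  simp only [C, sub_zero] at h00
  rw [integral_add (integrable_finsetSum _ fun i _ =>
      integrable_mul_of_memLp_volume (hψ i) (hu i)) (integrable_mul_of_memLp_volume hf hw),
    integral_finsetSum _ fun i _ => integrable_mul_of_memLp_volume (hψ i) (hu i), h00]

/-- Leibniz rule for the product of a weakly differentiable and a smooth function. -/
lemma HasWeakDeriv.smooth_mul {Ω : Set (Space d)} {i : Fin d} {v g θ : Space d → ℂ}
    (hv : MemLp v 2 (volume.restrict Ω)) (hg : MemLp g 2 (volume.restrict Ω))
    (h : HasWeakDeriv Ω i v g) (hθ : IsSmoothComp θ) :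
    HasWeakDeriv Ω i (fun x => θ x * v x) (fun x => θ x * g x + pderiv i θ x * v x) := by
  intro φ hφ
  have ht : IsTest Ω (fun x => θ x * φ x) := by
    refine ⟨hθ.1.mul hφ.1, hφ.2.1.mul_left, (closure_mono fun x hx => ?_).trans hφ.2.2⟩
    exact right_ne_zero_of_mul hx
  have h1 := h _ ht
  simp_rw [pderiv_mul hθ.1 hφ.1] at h1
  have hs := hφ.smooth
  have i1 := integrable_mul_of_memLp hv ((IsSmoothComp.mul hθ.1 (hs.pderiv i)).memLp Ω)
  have i2 := integrable_mul_of_memLp hv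
    ((IsSmoothComp.mul (hθ.pderiv i).1 hs).memLp Ω)
  have i3 := integrable_mul_of_memLp hg (ht.smooth.memLp Ω)
  have e1 : ∫ x in Ω, v x * (θ x * pderiv i φ x + pderiv i θ x * φ x) =
      (∫ x in Ω, v x * (θ x * pderiv i φ x)) + ∫ x in Ω, v x * (pderiv i θ x * φ x) := by
    rw [← integral_add i1 i2]
    simp_rw [mul_add]
  have e2 : ∫ x in Ω, (θ x * g x + pderiv i θ x * v x) * φ x =
      (∫ x in Ω, g x * (θ x * φ x)) + ∫ x in Ω, v x * (pderiv i θ x * φ x) := by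
    rw [← integral_add i3 i2]
    congr 1
    ext x
    ring
  have e3 : ∫ x in Ω, θ x * v x * pderiv i φ x = ∫ x in Ω, v x * (θ x * pderiv i φ x) := by
    congr 1
    ext x
    ring
  rw [e1] at h1
  rw [e2, e3, eq_sub_of_add_eq h1]
  ring

lemma exists_smooth_cutoff : ∃ θ : Space d → ℂ, IsSmoothComp θ ∧ (∀ x, ‖x‖ ≤ 1 → θ x = 1) := by
  let b : ContDiffBump (0 : Space d) := ⟨1, 2, one_pos, one_lt_two⟩
  refine ⟨fun x => (b x : ℂ), (IsTest.of_real b.contDiff b.hasCompactSupport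
    (subset_univ _)).smooth, fun x hx => ?_⟩
  have : b x = 1 := b.one_of_mem_closedBall (by simpa [b] using hx)
  simp [this]

/-- Green's formula `∫ ψ · ∇w + (div ψ) w = 0` for `ψ ∈ H(div, ℝ^d)` and `w ∈ H¹(ℝ^d)`: cutting off
reduces it to functions with compact support. -/
lemma green_univ {γ : ℝ} {ψ : Fin d → Space d → ℂ} {f : Space d → ℂ}
    (h : MemHDiv univ ψ f) (w : H1 γ (univ : Set (Space d))) :
    ∫ x, ((∑ i, ψ i x * gradOf w i x) + f x * fnOf w x) = 0 := by
  have hψ : ∀ i, MemLp (ψ i) 2 := fun i =>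
    memLp_of_restrict_univ (h.memLp i)
  have hf : MemLp f 2 :=
    memLp_of_restrict_univ (h.memLp_div)
  have hw : MemLp (fnOf w) 2 :=
    memLp_of_restrict_univ (Lp.memLp (fnOf w))
  have hu : ∀ i, MemLp (gradOf w i) 2 := fun i =>
    memLp_of_restrict_univ (Lp.memLp (gradOf w i))
  obtain ⟨θ, hθ, hθ1⟩ := exists_smooth_cutoff (d := d)
  obtain ⟨M, hM⟩ := hθ.1.continuous.bounded_above_of_compact_support hθ.2
  have hD : ∀ i, ∃ M, ∀ x, ‖pderiv i θ x‖ ≤ M := fun i =>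
    (hθ.pderiv i).1.continuous.bounded_above_of_compact_support (hθ.pderiv i).2
  choose N hN using hD
  let c : ℕ → ℝ := fun n => ((n : ℝ) + 1)⁻¹
  have hc0 : ∀ n, 0 < c n := fun n => by positivity
  have hc1 : ∀ n, c n ≤ 1 := fun n => inv_le_one_of_one_le₀ (by simp)
  have hc : Filter.Tendsto c Filter.atTop (𝓝 0) := by
    simpa [c, one_div] using tendsto_one_div_add_atTop_nhds_zero_nat (𝕜 := ℝ)
  let Θ : ℕ → Space d → ℂ := fun n x => θ (c n • x)
  have hΘ : ∀ n, IsSmoothComp (Θ n) := fun n =>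
    ⟨hθ.1.comp (contDiff_const_smul (c n)),
      hθ.2.comp_homeomorph (Homeomorph.smulOfNeZero (c n) (hc0 n).ne')⟩
  have hΘ' : ∀ n i x, pderiv i (Θ n) x = (c n : ℂ) * pderiv i θ (c n • x) := fun n i x => by
    simp only [pderiv, Θ]
    rw [fderiv_comp_smul]
    simp
  have hzero : ∀ n, ∫ x, ((∑ i, ψ i x * (Θ n x * gradOf w i x + pderiv i (Θ n) x * fnOf w x)) +
      f x * (Θ n x * fnOf w x)) = 0 := by
    intro n
    have hb : ∀ {g v : Space d → ℂ}, IsSmoothComp g → MemLp v 2 →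
        MemLp (fun x => g x * v x) 2 := fun {g v} hg hv => by
      obtain ⟨K, hK⟩ := hg.1.continuous.bounded_above_of_compact_support hg.2
      refine (hv.const_mul (K : ℂ)).of_le (hg.1.continuous.aestronglyMeasurable.mul hv.1)
        (Filter.Eventually.of_forall fun x => ?_)
      rw [norm_mul, norm_mul]
      refine mul_le_mul_of_nonneg_right ((hK x).trans ?_) (norm_nonneg _)
      rw [Complex.norm_real]
      exact le_abs_self K
    refine green_of_hasCompactSupport h (hb (hΘ n) hw)
      (fun i => (hb (hΘ n) (hu i)).add (hb ((hΘ n).pderiv i) hw)) (fun i => ?_)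
      (hΘ n).2.mul_right
    exact HasWeakDeriv.smooth_mul (Lp.memLp _) (Lp.memLp _) (hasWeakDeriv_gradOf w i) (hΘ n)
  have hΘlim : ∀ x, ∀ᶠ n in Filter.atTop, Θ n x = 1 := fun x => by
    have h1 : Filter.Tendsto (fun n => ‖c n • x‖) Filter.atTop (𝓝 0) := by
      have := (hc.smul_const x).norm
      simpa using this
    filter_upwards [h1.eventually_le_const one_pos] with n hn
    exact hθ1 _ hn
  have hΘlim' : ∀ i x, Filter.Tendsto (fun n => pderiv i (Θ n) x) Filter.atTop (𝓝 0) :=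
    fun i x => by
    -- the gradient of a cutoff at scale `n + 1` is of size `1 / (n + 1)`
    refine squeeze_zero_norm (a := fun n => c n * N i) (fun n => ?_)
      (by simpa using hc.mul_const (N i))
    rw [hΘ', norm_mul, Complex.norm_real, Real.norm_of_nonneg (hc0 n).le]
    exact mul_le_mul_of_nonneg_left (hN i _) (hc0 n).le
  have hlim := tendsto_integral_of_dominated_convergence
    (F := fun n x => (∑ i, ψ i x * (Θ n x * gradOf w i x + pderiv i (Θ n) x * fnOf w x)) +
      f x * (Θ n x * fnOf w x))
    (f := fun x => (∑ i, ψ i x * gradOf w i x) + f x * fnOf w x) (μ := volume)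
    (fun x => (∑ i, (M * ‖ψ i x * gradOf w i x‖ + N i * ‖ψ i x * fnOf w x‖)) +
      M * ‖f x * fnOf w x‖)
    (fun n => ?_) ?_ (fun n => ?_) ?_
  · simp_rw [hzero] at hlim
    exact tendsto_nhds_unique hlim tendsto_const_nhds
  · refine (Finset.aestronglyMeasurable_fun_sum _ fun i _ => ?_).add ?_
    · exact (hψ i).1.mul (((hΘ n).1.continuous.aestronglyMeasurable.mul (hu i).1).add
        (((hΘ n).pderiv i).1.continuous.aestronglyMeasurable.mul hw.1))
    · exact hf.1.mul ((hΘ n).1.continuous.aestronglyMeasurable.mul hw.1)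
  · refine (integrable_finsetSum _ fun i _ => ?_).add ?_
    · exact ((integrable_mul_of_memLp_volume (hψ i) (hu i)).norm.const_mul _).add
        ((integrable_mul_of_memLp_volume (hψ i) hw).norm.const_mul _)
    · exact (integrable_mul_of_memLp_volume hf hw).norm.const_mul _
  · refine Filter.Eventually.of_forall fun x => ?_
    have b1 : ‖Θ n x‖ ≤ M := hM _
    have b2 : ∀ i, ‖pderiv i (Θ n) x‖ ≤ N i := fun i => by
      rw [hΘ', norm_mul, Complex.norm_real, Real.norm_of_nonneg (hc0 n).le]
      exact (mul_le_of_le_one_left (norm_nonneg _) (hc1 n)).trans (hN i _)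
    refine (norm_add_le _ _).trans (add_le_add ((norm_sum_le _ _).trans
      (Finset.sum_le_sum fun i _ => ?_)) ?_)
    · rw [mul_add]
      refine (norm_add_le _ _).trans (add_le_add ?_ ?_)
      · rw [mul_left_comm, norm_mul]
        exact mul_le_mul_of_nonneg_right b1 (norm_nonneg _)
      · rw [mul_left_comm, norm_mul]
        exact mul_le_mul_of_nonneg_right (b2 i) (norm_nonneg _)
    · rw [mul_left_comm, norm_mul]
      exact mul_le_mul_of_nonneg_right b1 (norm_nonneg _)
  · refine Filter.Eventually.of_forall fun x => ?_
    have t1 : Filter.Tendsto (fun n => Θ n x) Filter.atTop (𝓝 1) :=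
      tendsto_const_nhds.congr' ((hΘlim x).mono fun n hn => hn.symm)
    have t2 : ∀ i, Filter.Tendsto (fun n => ψ i x * (Θ n x * gradOf w i x +
        pderiv i (Θ n) x * fnOf w x)) Filter.atTop (𝓝 (ψ i x * gradOf w i x)) := fun i => by
      simpa using ((t1.mul_const (gradOf w i x)).add
        ((hΘlim' i x).mul_const (fnOf w x))).const_mul (ψ i x)
    have t3 : Filter.Tendsto (fun n => f x * (Θ n x * fnOf w x)) Filter.atTop
        (𝓝 (f x * fnOf w x)) := by
      simpa using (t1.mul_const (fnOf w x)).const_mul (f x)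
    exact (tendsto_finsetSum _ fun i _ => t2 i).add t3

end

noncomputable section

/-! ### Coordinates adapted to a Lipschitz graph -/

/-- Orthonormal coordinates `x ↦ (s, y) ∈ ℝ × ℝⁿ` of `ℝⁿ⁺¹` whose first axis is `e`. The factor `ℝⁿ`
carries the sup norm, for which Lebesgue measure is the `n`-dimensional Hausdorff measure. -/
structure AxisCoords {n : ℕ} (e : Space (n + 1)) where
  /-- The coordinates of a point. -/
  toCoord : Space (n + 1) → ℝ × (Fin n → ℝ)
  /-- The point with given coordinates. -/
  ofCoord : ℝ × (Fin n → ℝ) → Space (n + 1)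
  measurePreserving : MeasurePreserving toCoord volume volume
  fst_toCoord : ∀ x, (toCoord x).1 = inner ℝ x e
  lipschitz_snd : LipschitzWith 1 (fun x => (toCoord x).2)
  continuous_ofCoord : Continuous ofCoord
  ofCoord_toCoord : ∀ x, ofCoord (toCoord x) = x
  toCoord_ofCoord : ∀ a, toCoord (ofCoord a) = a
  ofCoord_eq : ∀ s y, ofCoord (s, y) = ofCoord (0, y) + s • e

lemma nonempty_axisCoords {n : ℕ} {e : Space (n + 1)} (he : ‖e‖ = 1) :
    Nonempty (AxisCoords e) := by
  have ho : Orthonormal ℝ (({0} : Set (Fin (n + 1))).domRestrict fun _ => e) := by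
    refine ⟨fun i => he, fun i j hij => ?_⟩
    exact absurd (Subsingleton.elim i j) hij
  obtain ⟨b, hb⟩ := ho.exists_orthonormalBasis_extension_of_card_eq (by simp)
  have hb0 : b 0 = e := hb 0 rfl
  refine ⟨⟨fun x => (b.repr x 0, fun i => b.repr x i.succ),
    fun a => b.repr.symm (WithLp.toLp 2 (Fin.cons a.1 a.2)), ?_, ?_, ?_, ?_, ?_, ?_, ?_⟩⟩
  · exact ((volume_preserving_piFinSuccAbove (fun _ : Fin (n + 1) => ℝ) 0).comp
      (PiLp.volume_preserving_ofLp (Fin (n + 1)))).comp b.measurePreserving_repr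
  · intro x
    simp only
    rw [b.repr_apply_apply, hb0, real_inner_comm]
  · refine LipschitzWith.of_dist_le_mul fun x y => ?_
    rw [NNReal.coe_one, one_mul, dist_pi_le_iff dist_nonneg]
    intro i
    rw [← b.repr.dist_map x y, dist_eq_norm, dist_eq_norm]
    exact PiLp.norm_apply_le (b.repr x - b.repr y) i.succ
  · refine b.repr.symm.continuous.comp ((PiLp.continuous_toLp 2 _).comp ?_)
    exact continuous_pi fun i => Fin.cases (by simpa using continuous_fst)
      (fun j => by
        simp only [Fin.cons_succ]
        fun_prop) i
  · intro x
    have : WithLp.toLp 2 (Fin.cons (b.repr x 0) fun i : Fin n => b.repr x i.succ) = b.repr x := by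
      ext i
      exact Fin.cases rfl (fun j => rfl) i
    simp only
    rw [this, LinearIsometryEquiv.symm_apply_apply]
  · intro a
    simp
  · intro s y
    apply b.repr.injective
    rw [map_add, map_smul, LinearIsometryEquiv.apply_symm_apply,
      LinearIsometryEquiv.apply_symm_apply, ← hb0, b.repr_self]
    ext i
    refine Fin.cases ?_ (fun j => ?_) i
    · simp
    · simp

namespace AxisCoords

variable {n : ℕ} {e : Space (n + 1)} (c : AxisCoords e) {h : Space (n + 1) → ℝ}

/-- The height over `y` of the graph of a function `h` of the coordinates orthogonal to `e`. -/
def height (h : Space (n + 1) → ℝ) (y : Fin n → ℝ) : ℝ := h (c.ofCoord (0, y))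

/-- The point over `y` on the graph of `h`. -/
def graphMap (h : Space (n + 1) → ℝ) (y : Fin n → ℝ) : Space (n + 1) :=
  c.ofCoord (c.height h y, y)

lemma continuous_height (hc : Continuous h) : Continuous (c.height h) :=
  hc.comp (c.continuous_ofCoord.comp (by fun_prop))

lemma continuous_graphMap (hc : Continuous h) : Continuous (c.graphMap h) :=
  c.continuous_ofCoord.comp ((c.continuous_height hc).prodMk continuous_id)

lemma snd_toCoord_graphMap (y : Fin n → ℝ) : (c.toCoord (c.graphMap h y)).2 = y := by
  rw [graphMap, c.toCoord_ofCoord]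

lemma eq_add_smul (x : Space (n + 1)) :
    x = c.ofCoord (0, (c.toCoord x).2) + (inner ℝ x e : ℝ) • e := by
  rw [← c.fst_toCoord, ← c.ofCoord_eq, c.ofCoord_toCoord]

lemma height_snd (hinv : ∀ (y : Space (n + 1)) (t : ℝ), h (y + t • e) = h y)
    (x : Space (n + 1)) : c.height h (c.toCoord x).2 = h x := by
  conv_rhs => rw [c.eq_add_smul x, hinv]
  rfl

lemma sub_graphMap (hinv : ∀ (y : Space (n + 1)) (t : ℝ), h (y + t • e) = h y)
    (x : Space (n + 1)) :
    x - c.graphMap h (c.toCoord x).2 = (inner ℝ x e - h x) • e := by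
  rw [graphMap, c.height_snd hinv, c.ofCoord_eq]
  conv_lhs => enter [1]; rw [c.eq_add_smul x]
  rw [sub_smul]
  abel

lemma graphMap_mem (hinv : ∀ (y : Space (n + 1)) (t : ℝ), h (y + t • e) = h y)
    (y : Fin n → ℝ) : inner ℝ (c.graphMap h y) e = h (c.graphMap h y) := by
  rw [← c.height_snd hinv, c.snd_toCoord_graphMap, ← c.fst_toCoord, graphMap, c.toCoord_ofCoord]

/-- Graphs are Lebesgue null sets. -/
lemma volume_graph_eq_zero (c : AxisCoords e) (hc : Continuous h)
    (hinv : ∀ (y : Space (n + 1)) (t : ℝ), h (y + t • e) = h y) :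
    volume {x : Space (n + 1) | inner ℝ x e = h x} = 0 := by
  have hms : MeasurableSet {a : ℝ × (Fin n → ℝ) | a.1 = c.height h a.2} :=
    measurableSet_eq_fun measurable_fst ((c.continuous_height hc).measurable.comp measurable_snd)
  have e1 : {x : Space (n + 1) | inner ℝ x e = h x} =
      c.toCoord ⁻¹' {a | a.1 = c.height h a.2} := by
    ext x
    simp only [mem_ofPred_eq, mem_preimage]
    rw [c.fst_toCoord, c.height_snd hinv]
  rw [e1, c.measurePreserving.measure_preimage hms.nullMeasurableSet,
    show (volume : Measure (ℝ × (Fin n → ℝ))) = volume.prod volume from rfl,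
    Measure.prod_apply_symm hms]
  refine (lintegral_congr fun y => ?_).trans lintegral_zero
  have : (fun x => (x, y)) ⁻¹' {a : ℝ × (Fin n → ℝ) | a.1 = c.height h a.2} =
      {c.height h y} := by
    ext s; simp
  rw [this, Real.volume_singleton]

/-- The orthogonal projection along `e` is nonexpansive, so the projected Lebesgue measure of a part
of a graph is at most its surface measure. -/
lemma map_graphMap_restrict_le (hc : Continuous h) {Ω U : Set (Space (n + 1))}
    (hU : MeasurableSet U) (hfr : ∀ x ∈ U, (∃ y, c.graphMap h y = x) → x ∈ frontier Ω) :
    (Measure.map (c.graphMap h) volume).restrict U ≤ surface Ω := by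
  refine Measure.le_iff.2 fun A hA => ?_
  have hdim : (((n + 1 : ℕ) : ℝ) - 1) = (Fintype.card (Fin n) : ℝ) := by
    rw [Fintype.card_fin]; push_cast; ring
  rw [Measure.restrict_apply hA, surface, Measure.restrict_apply hA, hdim,
    Measure.map_apply (c.continuous_graphMap hc).measurable (hA.inter hU),
    ← hausdorffMeasure_pi_real]
  have hsub : c.graphMap h ⁻¹' (A ∩ U) ⊆ (fun x => (c.toCoord x).2) '' (A ∩ frontier Ω) :=
    fun y hy => ⟨c.graphMap h y, ⟨hy.1, hfr _ hy.2 ⟨y, rfl⟩⟩, c.snd_toCoord_graphMap y⟩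
  refine (measure_mono hsub).trans ?_
  have := c.lipschitz_snd.hausdorffMeasure_image_le (d := (Fintype.card (Fin n) : ℝ))
    (by positivity) (A ∩ frontier Ω)
  simpa using this

/-- The integral over a slab of width `2δ` around the graph, compared with the integral over the
graph. -/
lemma lintegral_slab_le (he : ‖e‖ = 1) (hc : Continuous h)
    (hinv : ∀ (y : Space (n + 1)) (t : ℝ), h (y + t • e) = h y)
    {g : Space (n + 1) → ℂ} {L : NNReal} (hg : LipschitzWith L g) (hgs : HasCompactSupport g)
    (δ : ℝ) :
    ∫⁻ x in {x : Space (n + 1) | |inner ℝ x e - h x| ≤ δ}, ‖g x‖ₑ ≤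
      ENNReal.ofReal (2 * δ) * ∫⁻ y in (fun x => (c.toCoord x).2) '' (tsupport g),
        (‖g (c.graphMap h y)‖ₑ + L * ENNReal.ofReal δ) := by
  set B := (fun x => (c.toCoord x).2) '' (tsupport g) with hB
  have hBm : MeasurableSet B :=
    (hgs.isCompact.image c.lipschitz_snd.continuous).isClosed.measurableSet
  have hh := c.continuous_height hc
  have hΓ := c.continuous_graphMap hc
  let k : (Fin n → ℝ) → ℝ≥0∞ :=
    B.indicator fun y => ‖g (c.graphMap h y)‖ₑ + L * ENNReal.ofReal δ
  have hk : Measurable k := Measurable.indicator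
    ((hg.continuous.comp hΓ).measurable.enorm.add_const _) hBm
  let T : Set (ℝ × (Fin n → ℝ)) := {a | |a.1 - c.height h a.2| ≤ δ}
  have hT : MeasurableSet T := by
    refine measurableSet_le ?_ measurable_const
    exact (continuous_fst.sub (hh.comp continuous_snd)).abs.measurable
  let F : ℝ × (Fin n → ℝ) → ℝ≥0∞ := T.indicator fun a => k a.2
  have hF : Measurable F := (hk.comp measurable_snd).indicator hT
  have hS : MeasurableSet {x : Space (n + 1) | |inner ℝ x e - h x| ≤ δ} := by
    refine measurableSet_le ?_ measurable_const
    exact ((continuous_id.inner continuous_const).sub hc).abs.measurable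
  have hslab : ∫⁻ x in {x : Space (n + 1) | |inner ℝ x e - h x| ≤ δ}, ‖g x‖ₑ ≤
      ∫⁻ x, F (c.toCoord x) := by
    rw [← lintegral_indicator hS]
    refine lintegral_mono (indicator_le fun x hx => ?_)
    by_cases hgx : g x = 0
    · simp [hgx]
    have hxB : (c.toCoord x).2 ∈ B := ⟨x, subset_tsupport g hgx, rfl⟩
    have hxT : c.toCoord x ∈ T := by
      change |(c.toCoord x).1 - c.height h (c.toCoord x).2| ≤ δ
      rw [c.fst_toCoord, c.height_snd hinv]
      exact hx
    simp only [F, k]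
    rw [indicator_of_mem hxT, indicator_of_mem hxB]
    have h1 : ‖g x - g (c.graphMap h (c.toCoord x).2)‖ₑ ≤ L * ENNReal.ofReal δ := by
      rw [← edist_eq_enorm_sub]
      refine (hg _ _).trans ?_
      gcongr
      rw [edist_dist, dist_eq_norm, c.sub_graphMap hinv, norm_smul, he, mul_one]
      exact ENNReal.ofReal_le_ofReal hx
    calc ‖g x‖ₑ = ‖g (c.graphMap h (c.toCoord x).2) +
          (g x - g (c.graphMap h (c.toCoord x).2))‖ₑ := by congr 1; ring
      _ ≤ _ := (enorm_add_le _ _).trans (by gcongr)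
  refine hslab.trans (le_of_eq ?_)
  rw [c.measurePreserving.lintegral_comp hF,
    show (volume : Measure (ℝ × (Fin n → ℝ))) = volume.prod volume from rfl,
    lintegral_prod_symm _ hF.aemeasurable]
  have hsection : ∀ y, ∫⁻ s, F (s, y) = ENNReal.ofReal (2 * δ) * k y := by
    intro y
    have e1 : ∀ s, F (s, y) = (Metric.closedBall (c.height h y) δ).indicator (fun _ => k y) s := by
      intro s
      simp only [F, indicator, T, mem_ofPred_eq, Metric.mem_closedBall, Real.dist_eq]
    simp_rw [e1]
    rw [lintegral_indicator Metric.isClosed_closedBall.measurableSet, setLIntegral_const,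
      Real.volume_closedBall, mul_comm]
  simp_rw [hsection]
  rw [lintegral_const_mul _ hk, lintegral_indicator hBm]

/-- For `G` below the graph, `|∫_G ∂_v g|` is controlled by the integral of `|g|` over the graph. The
left side is the derivative at `t = 0` of `∫_{G + tv} g`, and `G + tv` differs from `G` only in a slab
of width `O(t)`; no differentiability of `h` is used. -/
lemma enorm_setIntegral_fderiv_le (he : ‖e‖ = 1) {K : NNReal} (hK : LipschitzWith K h)
    (hinv : ∀ (y : Space (n + 1)) (t : ℝ), h (y + t • e) = h y)
    {g : Space (n + 1) → ℂ} (hg : IsSmoothComp g) (v : Space (n + 1)) :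
    ‖∫ x in {x : Space (n + 1) | inner ℝ x e < h x}, fderiv ℝ g x v‖ₑ ≤
      ENNReal.ofReal (2 * ((1 + K) * ‖v‖)) * ∫⁻ y, ‖g (c.graphMap h y)‖ₑ := by
  have hc := hK.continuous
  set G := {x : Space (n + 1) | inner ℝ x e < h x} with hG
  have hGm : MeasurableSet G :=
    measurableSet_lt (continuous_id.inner continuous_const).measurable hc.measurable
  set C : ℝ := (1 + K) * ‖v‖ with hC
  have hC0 : 0 ≤ C := by positivity
  obtain ⟨L, hL⟩ := hg.1.lipschitzWith_of_hasCompactSupport hg.2 (by simp)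
  set B := (fun x => (c.toCoord x).2) '' (tsupport g) with hB
  have hBc : IsCompact B := hg.2.isCompact.image c.lipschitz_snd.continuous
  -- `A z = ∫_G g(x - z) dx`, written as a convolution in order to differentiate it
  let χ : Space (n + 1) → ℝ := G.indicator fun _ => 1
  let g' : Space (n + 1) → ℂ := fun x => g (-x)
  have hg1 : ContDiff ℝ ∞ g' := hg.1.comp contDiff_neg
  have hg2 : HasCompactSupport g' := hg.2.comp_homeomorph (Homeomorph.neg _)
  have hχ : LocallyIntegrable χ := (locallyIntegrable_const 1).indicator hGm
  let A : Space (n + 1) → ℂ := convolution χ g' (ContinuousLinearMap.lsmul ℝ ℝ) volume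
  have hA : ∀ z, A z = ∫ x, χ (x + z) • g x := by
    intro z
    simp only [A, convolution_def]
    rw [← integral_add_right_eq_self _ z]
    refine integral_congr_ae (Filter.Eventually.of_forall fun x => ?_)
    simp [g']
  have hfd : ∀ x, fderiv ℝ g' x v = - fderiv ℝ g (-x) v := fun x => by
    have h5 := ((hg.1.differentiable (by simp)) (-x)).hasFDerivAt.comp x (hasFDerivAt_id x).neg
    have h6 := h5.fderiv
    change fderiv ℝ g' x = _ at h6
    rw [h6]
    simp
  have hAd : HasDerivAt (fun t : ℝ => A (t • v)) (-∫ x in G, fderiv ℝ g x v) 0 := by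
    have h1 := hg2.hasFDerivAt_convolution_right (ContinuousLinearMap.lsmul ℝ ℝ) hχ
      (hg1.of_le (by simp)) ((0 : ℝ) • v)
    have h2 : HasDerivAt (fun t : ℝ => t • v) v 0 := by
      simpa using (hasDerivAt_id (0 : ℝ)).smul_const v
    have h3 := h1.comp_hasDerivAt (0 : ℝ) h2
    rw [convolution_precompR_apply _ hχ (hg2.fderiv ℝ) (hg1.continuous_fderiv (by simp)),
      convolution_def] at h3
    convert! h3 using 1
    rw [← integral_indicator hGm, ← integral_neg]
    refine integral_congr_ae (Filter.Eventually.of_forall fun x => ?_)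
    simp only [hfd, zero_smul, zero_sub, neg_neg, ContinuousLinearMap.lsmul_apply, χ, indicator]
    split_ifs <;> simp
  have hslope := hAd.tendsto_slope_zero_right
  have hbound : ∀ t ∈ Ioi (0 : ℝ), ‖t⁻¹ • (A ((0 + t) • v) - A ((0 : ℝ) • v))‖ₑ ≤
      ENNReal.ofReal (2 * C) * ((∫⁻ y, ‖g (c.graphMap h y)‖ₑ) +
        L * ENNReal.ofReal (C * t) * volume B) := by
    intro t ht
    have ht0 : (0 : ℝ) < t := ht
    have hi : ∀ z, Integrable (fun x => χ (x + z) • g x) := fun z => by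
      have hgi : Integrable g := hg.1.continuous.integrable_of_hasCompactSupport hg.2
      refine hgi.mono ?_ (Filter.Eventually.of_forall fun x => ?_)
      · exact (((measurable_const (a := (1 : ℝ))).indicator hGm).comp
          (measurable_add_const z)).aestronglyMeasurable.smul hgi.1
      · rw [norm_smul]
        refine mul_le_of_le_one_left (norm_nonneg _) ?_
        simp only [χ, indicator]
        split_ifs <;> simp
    have hdiff : ‖A (t • v) - A ((0 : ℝ) • v)‖ₑ ≤
        ∫⁻ x in {x : Space (n + 1) | |inner ℝ x e - h x| ≤ C * t}, ‖g x‖ₑ := by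
      rw [hA, hA, ← integral_sub (hi _) (hi _)]
      refine (enorm_integral_le_lintegral_enorm _).trans ?_
      have hS : MeasurableSet {x : Space (n + 1) | |inner ℝ x e - h x| ≤ C * t} := by
        refine measurableSet_le ?_ measurable_const
        exact ((continuous_id.inner continuous_const).sub hc).abs.measurable
      rw [← lintegral_indicator hS]
      refine lintegral_mono fun x => ?_
      simp only [zero_smul, add_zero]
      have hvt : |inner ℝ (t • v) e| ≤ t * ‖v‖ := by
        have := abs_real_inner_le_norm (t • v) e
        rwa [he, mul_one, norm_smul, Real.norm_of_nonneg ht0.le] at this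
      have hht : |h (x + t • v) - h x| ≤ K * (t * ‖v‖) := by
        have := hK.dist_le_mul (x + t • v) x
        rwa [Real.dist_eq, dist_eq_norm, add_sub_cancel_left, norm_smul,
          Real.norm_of_nonneg ht0.le] at this
      have hin : inner ℝ (x + t • v) e = inner ℝ x e + inner ℝ (t • v) e := inner_add_left _ _ _
      have hCt : C * t = t * ‖v‖ + K * (t * ‖v‖) := by rw [hC]; ring
      rw [abs_le] at hvt hht
      by_cases hx : |inner ℝ x e - h x| ≤ C * t
      · rw [indicator_of_mem (by exact hx), ← sub_smul, enorm_smul]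
        refine mul_le_of_le_one_left zero_le ?_
        simp only [χ, indicator]
        split_ifs <;> simp
      · rw [abs_le, not_and_or, not_le, not_le] at hx
        have hiff : x + t • v ∈ G ↔ x ∈ G := by
          simp only [hG, mem_ofPred_eq]
          rw [hin]
          rcases hx with hx | hx
          · constructor <;> intro _ <;> linarith [hvt.1, hvt.2, hht.1, hht.2]
          · constructor <;> intro _ <;> linarith [hvt.1, hvt.2, hht.1, hht.2]
        have : χ (x + t • v) = χ x := by
          simp only [χ, indicator, hiff]
        rw [this, sub_self]
        simp
    rw [zero_add, enorm_smul]
    refine (mul_le_mul_right (hdiff.trans (c.lintegral_slab_le he hc hinv hL hg.2 _)) _).trans ?_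
    have hfin : ‖t⁻¹‖ₑ * ENNReal.ofReal (2 * (C * t)) = ENNReal.ofReal (2 * C) := by
      rw [Real.enorm_of_nonneg (by positivity), ← ENNReal.ofReal_mul (by positivity)]
      congr 1
      field_simp
    rw [← mul_assoc, hfin, lintegral_add_right _ measurable_const, setLIntegral_const]
    gcongr
    exact Measure.restrict_le_self
  have hlim : Filter.Tendsto (fun t : ℝ => ENNReal.ofReal (2 * C) *
      ((∫⁻ y, ‖g (c.graphMap h y)‖ₑ) + L * ENNReal.ofReal (C * t) * volume B)) (𝓝[>] 0)
      (𝓝 (ENNReal.ofReal (2 * C) * ((∫⁻ y, ‖g (c.graphMap h y)‖ₑ) + 0))) := by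
    refine ENNReal.Tendsto.const_mul (tendsto_const_nhds.add ?_) (Or.inr ENNReal.ofReal_ne_top)
    have h1 : Filter.Tendsto (fun t : ℝ => ENNReal.ofReal (C * t)) (𝓝[>] 0) (𝓝 0) := by
      have : Filter.Tendsto (fun t : ℝ => ENNReal.ofReal (C * t)) (𝓝 0)
          (𝓝 (ENNReal.ofReal (C * 0))) :=
        (ENNReal.continuous_ofReal.comp (continuous_const.mul continuous_id)).tendsto 0
      rw [mul_zero, ENNReal.ofReal_zero] at this
      exact this.mono_left nhdsWithin_le_nhds
    have h2 := ENNReal.Tendsto.const_mul (a := (L : ℝ≥0∞)) h1 (Or.inr ENNReal.coe_ne_top)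
    have h3 := ENNReal.Tendsto.mul_const (b := volume B) h2 (Or.inr hBc.measure_ne_top)
    simpa using h3
  have := le_of_tendsto_of_tendsto hslope.enorm hlim
    (Filter.eventually_of_mem self_mem_nhdsWithin hbound)
  rwa [add_zero, enorm_neg] at this

end AxisCoords

end

noncomputable section

/-! ### Lipschitz domains and extension by zero -/

section Lipschitz

variable {n : ℕ} {Ω : Set (Space (n + 1))}

lemma IsLipschitzOpen.exists_chart (hΩ : IsLipschitzOpen Ω) {x : Space (n + 1)}
    (hx : x ∈ frontier Ω) :
    ∃ (V : Set (Space (n + 1))) (e : Space (n + 1)) (h : Space (n + 1) → ℝ) (K : NNReal),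
      IsOpen V ∧ x ∈ V ∧ ‖e‖ = 1 ∧ LipschitzWith K h ∧
      (∀ (y : Space (n + 1)) (t : ℝ), h (y + t • e) = h y) ∧
      (∀ y ∈ V, (y ∈ Ω ↔ inner ℝ y e < h y)) ∧
      ∀ y ∈ V, (y ∈ frontier Ω ↔ inner ℝ y e = h y) := by
  obtain ⟨e, h, he, ⟨K, hK⟩, hinv, U, hU, hUΩ⟩ := hΩ.2 x hx
  have hc := hK.continuous
  have hV : ∀ y ∈ interior U, (y ∈ Ω ↔ inner ℝ y e < h y) := fun y hy =>
    hUΩ y (interior_subset hy)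
  refine ⟨interior U, e, h, K, isOpen_interior, mem_interior_iff_mem_nhds.2 hU, he, hK, hinv,
    hV, fun y hy => ?_⟩
  rw [hΩ.1.frontier_eq]
  constructor
  · rintro ⟨hy1, hy2⟩
    rw [hV y hy, not_lt] at hy2
    refine le_antisymm ?_ hy2
    by_contra hlt
    rw [not_le] at hlt
    have ho : IsOpen (interior U ∩ {z | h z < inner ℝ z e}) :=
      isOpen_interior.inter (isOpen_lt hc (continuous_id.inner continuous_const))
    obtain ⟨z, ⟨hz1, hz2⟩, hz3⟩ := mem_closure_iff.1 hy1 _ ho ⟨hy, hlt⟩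
    exact lt_asymm hz2 ((hV z hz1).1 hz3)
  · intro hy1
    refine ⟨?_, fun hy2 => (((hV y hy).1 hy2).ne hy1)⟩
    have ht : Filter.Tendsto (fun t : ℝ => y + (-t) • e) (𝓝[>] 0) (𝓝 y) := by
      have : Filter.Tendsto (fun t : ℝ => y + (-t) • e) (𝓝 0) (𝓝 (y + (-0 : ℝ) • e)) :=
        (Continuous.tendsto (by fun_prop) 0)
      simp only [neg_zero, zero_smul, add_zero] at this
      exact this.mono_left nhdsWithin_le_nhds
    refine mem_closure_of_tendsto ht ?_
    filter_upwards [ht (isOpen_interior.mem_nhds hy), self_mem_nhdsWithin] with t ht1 ht2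
    rw [hV _ ht1, hinv, inner_add_left, inner_smul_left, real_inner_self_eq_norm_sq, he, hy1]
    have : (0 : ℝ) < t := ht2
    simp [this]

/-- The boundary of a Lipschitz open set is a Lebesgue null set. -/
lemma IsLipschitzOpen.volume_frontier (hΩ : IsLipschitzOpen Ω) : volume (frontier Ω) = 0 := by
  refine measure_null_of_locally_null _ fun x hx => ?_
  obtain ⟨V, e, h, K, hVo, hxV, he, hK, hinv, -, hfr⟩ := hΩ.exists_chart hx
  obtain ⟨c⟩ := nonempty_axisCoords he
  refine ⟨V ∩ frontier Ω, Filter.inter_mem (mem_nhdsWithin_of_mem_nhds (hVo.mem_nhds hxV))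
    self_mem_nhdsWithin, ?_⟩
  exact measure_mono_null (fun y hy => (hfr y hy.1).1 hy.2)
    (c.volume_graph_eq_zero hK.continuous hinv)

lemma AxisCoords.memLp_map_graphMap {e : Space (n + 1)} (c : AxisCoords e)
    {h : Space (n + 1) → ℝ} (hc : Continuous h) {η : Space (n + 1) → ℂ} (hη : IsSmoothComp η) :
    MemLp η 2 (Measure.map (c.graphMap h) volume) := by
  have hΓ := c.continuous_graphMap hc
  rw [memLp_map_measure_iff hη.1.continuous.aestronglyMeasurable hΓ.aemeasurable]
  refine (hη.1.continuous.comp hΓ).memLp_of_hasCompactSupport ?_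
  refine HasCompactSupport.intro (hη.2.isCompact.image c.lipschitz_snd.continuous)
    fun y hy => ?_
  by_contra hne
  exact hy ⟨c.graphMap h y, subset_tsupport η hne, c.snd_toCoord_graphMap y⟩

/-- Cauchy-Schwarz on a piece `V` of a graph that lies in `∂Ω`. -/
lemma AxisCoords.lintegral_graphMap_mul_le {e : Space (n + 1)} (c : AxisCoords e)
    {h : Space (n + 1) → ℝ} (hc : Continuous h) {V : Set (Space (n + 1))} (hV : MeasurableSet V)
    (hfr : ∀ x ∈ V, (∃ y, c.graphMap h y = x) → x ∈ frontier Ω) {φ η : Space (n + 1) → ℂ}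
    (hφ : Continuous φ) (hη : Continuous η) (hηV : ∀ x ∉ V, η x = 0) :
    ∫⁻ y, ‖φ (c.graphMap h y) * η (c.graphMap h y)‖ₑ ≤
      eLpNorm η 2 (Measure.map (c.graphMap h) volume) * eLpNorm φ 2 (surface Ω) := by
  have hΓ := c.continuous_graphMap hc
  have e2 : ∫⁻ y, ‖φ (c.graphMap h y) * η (c.graphMap h y)‖ₑ =
      eLpNorm (φ • η) 1 ((Measure.map (c.graphMap h) volume).restrict V) := by
    rw [eLpNorm_one_eq_lintegral_enorm, ← lintegral_indicator hV,
      ← lintegral_map (f := fun x => ‖φ x * η x‖ₑ) (hφ.mul hη).measurable.enorm hΓ.measurable]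
    refine lintegral_congr fun y => ?_
    by_cases hy : y ∈ V
    · rw [indicator_of_mem hy]
      rfl
    · rw [indicator_of_notMem hy, hηV y hy, mul_zero, enorm_zero]
  rw [e2, mul_comm]
  refine (eLpNorm_smul_le_mul_eLpNorm (p := 2) (q := 2) (r := 1)
    hη.aestronglyMeasurable hφ.aestronglyMeasurable).trans ?_
  gcongr
  · exact c.map_graphMap_restrict_le hc hV hfr
  · exact Measure.restrict_le_self

/-- Near a boundary point, `∫_Ω ∂_i(φ η)` is controlled by the `L²(∂Ω)` norm of `φ`. -/
lemma IsLipschitzOpen.exists_boundary_estimate (hΩ : IsLipschitzOpen Ω) {x : Space (n + 1)}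
    (hx : x ∈ frontier Ω) :
    ∃ V, IsOpen V ∧ x ∈ V ∧ ∀ η : Space (n + 1) → ℂ, IsSmoothComp η → tsupport η ⊆ V →
      ∀ i, ∃ C : ℝ≥0∞, C ≠ ⊤ ∧ ∀ φ : Space (n + 1) → ℂ, IsSmoothComp φ →
        ‖∫ y in Ω, pderiv i (fun y => φ y * η y) y‖ₑ ≤ C * eLpNorm φ 2 (surface Ω) := by
  obtain ⟨V, e, h, K, hVo, hxV, he, hK, hinv, hin, hfr⟩ := hΩ.exists_chart hx
  obtain ⟨c⟩ := nonempty_axisCoords he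
  refine ⟨V, hVo, hxV, fun η hη hηV i => ?_⟩
  have hc := hK.continuous
  refine ⟨ENNReal.ofReal (2 * ((1 + K) * ‖(EuclideanSpace.single i 1 : Space (n + 1))‖)) *
      eLpNorm η 2 (Measure.map (c.graphMap h) volume),
    ENNReal.mul_ne_top ENNReal.ofReal_ne_top (c.memLp_map_graphMap hc hη).eLpNorm_ne_top,
    fun φ hφ => ?_⟩
  have htg : tsupport (fun y => φ y * η y) ⊆ tsupport η :=
    closure_mono fun y hy => right_ne_zero_of_mul hy
  have hdV : ∀ y ∉ V, pderiv i (fun y => φ y * η y) y = 0 := fun y hy =>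
    image_eq_zero_of_notMem_tsupport fun hh =>
      hy (hηV (htg (tsupport_pderiv_subset _ i hh)))
  have hGm : MeasurableSet {y : Space (n + 1) | inner ℝ y e < h y} :=
    measurableSet_lt (continuous_id.inner continuous_const).measurable hc.measurable
  have e1 : ∫ y in Ω, pderiv i (fun y => φ y * η y) y =
      ∫ y in {y : Space (n + 1) | inner ℝ y e < h y}, pderiv i (fun y => φ y * η y) y := by
    rw [← integral_indicator hΩ.1.measurableSet, ← integral_indicator hGm]
    congr 1
    ext y
    by_cases hy : y ∈ V
    · simp only [indicator, mem_ofPred_eq, hin y hy]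
    · simp only [indicator, hdV y hy, ite_self]
  rw [e1, mul_assoc]
  refine (c.enorm_setIntegral_fderiv_le he hK hinv (IsSmoothComp.mul hφ.1 hη) _).trans ?_
  refine mul_le_mul_right ?_ _
  refine c.lintegral_graphMap_mul_le hc hVo.measurableSet (fun y hy hy' => ?_)
    hφ.1.continuous hη.1.continuous fun y hy => ?_
  · obtain ⟨z, rfl⟩ := hy'
    exact (hfr _ hy).2 (c.graphMap_mem hinv z)
  · exact image_eq_zero_of_notMem_tsupport fun hh => hy (hηV hh)

end Lipschitz

variable {d : ℕ} {γ : ℝ} {Ω : Set (Space d)}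

/-- Localization: an additive property of functions in `C^∞_comp(ℝ^d)` holds for all of them as soon as
each point has a neighbourhood such that it holds for the functions supported there. -/
lemma IsSmoothComp.induction_local {P : (Space d → ℂ) → Prop} (h0 : P 0)
    (hadd : ∀ η η', IsSmoothComp η → IsSmoothComp η' → P η → P η' → P (η + η'))
    (hloc : ∀ x, ∃ V, IsOpen V ∧ x ∈ V ∧ ∀ η, IsSmoothComp η → tsupport η ⊆ V → P η)
    {η : Space d → ℂ} (hη : IsSmoothComp η) : P η := by
  choose V hVo hxV hP using hloc
  have hr : ∀ x, ∃ r > 0, Metric.closedBall x r ⊆ V x := fun x =>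
    Metric.nhds_basis_closedBall.mem_iff.1 ((hVo x).mem_nhds (hxV x))
  choose r hr0 hrV using hr
  let b : ∀ x : Space d, ContDiffBump x := fun x =>
    ⟨r x / 2, r x, half_pos (hr0 x), half_lt_self (hr0 x)⟩
  have key : ∀ (s : Finset (Space d)) (η : Space d → ℂ), IsSmoothComp η →
      Function.support η ⊆ ⋃ x ∈ s, Metric.ball x (r x / 2) → P η := by
    intro s
    induction s using Finset.induction_on with
    | empty =>
      intro η _ hs
      have : η = 0 := by
        rw [← Function.support_eq_empty_iff, ← subset_empty_iff]
        simpa using hs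
      rw [this]
      exact h0
    | insert a s _ ih =>
      intro η hη hs
      have hb : ContDiff ℝ ∞ (fun x => (b a x : ℂ)) :=
        Complex.ofRealCLM.contDiff.comp (b a).contDiff
      have h1 : IsSmoothComp (fun x => (b a x : ℂ) * η x) := IsSmoothComp.mul hb hη
      have h2 : IsSmoothComp (fun x => (1 - (b a x : ℂ)) * η x) :=
        IsSmoothComp.mul (contDiff_const.sub hb) hη
      have e : η = (fun x => (b a x : ℂ) * η x) + fun x => (1 - (b a x : ℂ)) * η x := by
        ext x
        simp only [Pi.add_apply]
        ring
      rw [e]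
      refine hadd _ _ h1 h2 (hP a _ h1 ?_) (ih _ h2 fun x hx => ?_)
      · refine (closure_mono fun x hx => ?_).trans ((b a).tsupport_eq.trans_subset (hrV a))
        have := left_ne_zero_of_mul hx
        exact fun hh => this (by simp [hh])
      · have hx1 := left_ne_zero_of_mul hx
        have hx2 := hs (right_ne_zero_of_mul hx)
        simp only [Finset.mem_insert, iUnion_iUnion_eq_or_left, mem_union] at hx2
        refine hx2.resolve_left fun hxa => hx1 ?_
        rw [(b a).one_of_mem_closedBall (Metric.ball_subset_closedBall hxa)]
        simp
  obtain ⟨s, hs⟩ := hη.2.isCompact.elim_finite_subcover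
    (fun x => Metric.ball x (r x / 2)) (fun x => Metric.isOpen_ball)
    (fun x _ => mem_iUnion.2 ⟨x, Metric.mem_ball_self (half_pos (hr0 x))⟩)
  exact key s η hη ((subset_tsupport η).trans hs)

/-- The functional `w ↦ ∫_Ω w ∂_i η + ∂_i w η`, which measures the boundary term in an integration by
parts. -/
def boundaryTerm (γ : ℝ) (Ω : Set (Space d)) {η : Space d → ℂ} (hη : IsSmoothComp η)
    (i : Fin d) : H1 γ Ω →L[ℂ] ℂ :=
  (pairing (pderiv i η) (hη.memLp_pderiv Ω i)).comp (fnOfL γ Ω) +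
    (pairing η (hη.memLp Ω)).comp (gradOfL γ Ω i)

lemma boundaryTerm_apply {η : Space d → ℂ} (hη : IsSmoothComp η) (i : Fin d) (w : H1 γ Ω) :
    boundaryTerm γ Ω hη i w =
      (∫ x in Ω, fnOf w x * pderiv i η x) + ∫ x in Ω, gradOf w i x * η x := by
  simp only [boundaryTerm, _root_.add_apply, ContinuousLinearMap.comp_apply, fnOfL_apply,
    gradOfL_apply, pairing_apply]
  simp_rw [mul_comm]

lemma boundaryTerm_of_smooth (hΩ : IsOpen Ω) {η φ : Space d → ℂ} (hη : IsSmoothComp η)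
    (hφ : IsSmoothComp φ) (i : Fin d) {w : H1 γ Ω} (hw : fnOf w =ᵐ[volume.restrict Ω] φ) :
    boundaryTerm γ Ω hη i w = ∫ x in Ω, pderiv i (fun x => φ x * η x) x := by
  have hg := gradOf_ae_eq hΩ w hw (hφ.memLp_pderiv Ω i) (HasWeakDeriv.of_smooth hφ i)
  rw [boundaryTerm_apply, ← integral_add
    (integrable_mul_of_memLp (Lp.memLp _) (hη.memLp_pderiv Ω i))
    (integrable_mul_of_memLp (Lp.memLp _) (hη.memLp Ω))]
  refine integral_congr_ae ?_
  filter_upwards [hw, hg] with x h1 h2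
  rw [pderiv_mul hφ.1 hη.1, h1, h2]

/-- No boundary term appears for functions with trace zero on a Lipschitz domain. -/
lemma boundaryTerm_eq_zero {n : ℕ} {Ω : Set (Space (n + 1))} (hΩ : IsLipschitzOpen Ω)
    {w : H1 γ Ω} (hw : w ∈ traceZero γ Ω) (i : Fin (n + 1)) {η : Space (n + 1) → ℂ}
    (hη : IsSmoothComp η) :
    (∫ x in Ω, fnOf w x * pderiv i η x) + ∫ x in Ω, gradOf w i x * η x = 0 := by
  refine IsSmoothComp.induction_local (P := fun η =>
    (∫ x in Ω, fnOf w x * pderiv i η x) + ∫ x in Ω, gradOf w i x * η x = 0) ?_ ?_ ?_ hη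
  · have : pderiv i (0 : Space (n + 1) → ℂ) = 0 := by
      ext x
      simp [pderiv]
    simp [this]
  · intro η η' h1 h2 e1 e2
    have e3 : ∀ x, pderiv i (η + η') x = pderiv i η x + pderiv i η' x := fun x => by
      simp only [pderiv]
      rw [fderiv_add ((h1.1.differentiable (by simp)) x) ((h2.1.differentiable (by simp)) x)]
      rfl
    simp_rw [e3, Pi.add_apply, mul_add]
    rw [integral_add (integrable_mul_of_memLp (Lp.memLp _) (h1.memLp_pderiv Ω i))
        (integrable_mul_of_memLp (Lp.memLp _) (h2.memLp_pderiv Ω i)),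
      integral_add (integrable_mul_of_memLp (Lp.memLp _) (h1.memLp Ω))
        (integrable_mul_of_memLp (Lp.memLp _) (h2.memLp Ω)), add_add_add_comm, e1, e2, add_zero]
  · intro x
    by_cases hx : x ∈ frontier Ω
    · obtain ⟨V, hVo, hxV, hV⟩ := hΩ.exists_boundary_estimate hx
      refine ⟨V, hVo, hxV, fun η hη hηV => ?_⟩
      obtain ⟨C, hC, hest⟩ := hV η hη hηV i
      rw [← boundaryTerm_apply hη]
      -- the estimate passes to the closure of the graph of the trace, which contains `(w, 0)`
      have hcl : IsClosed {a : H1 γ Ω × Lp ℂ 2 (surface Ω) |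
          ‖boundaryTerm γ Ω hη i a.1‖ ≤ C.toReal * ‖a.2‖} := by
        refine isClosed_le ?_ ?_
        · exact ((boundaryTerm γ Ω hη i).continuous.comp continuous_fst).norm
        · exact continuous_const.mul continuous_snd.norm
      have hsub : (smoothTraceGraph γ Ω : Set (H1 γ Ω × Lp ℂ 2 (surface Ω))) ⊆
          {a | ‖boundaryTerm γ Ω hη i a.1‖ ≤ C.toReal * ‖a.2‖} := by
        rintro a ⟨φ, hφ, h1, h2⟩
        have h3 := hest φ hφ
        rw [← boundaryTerm_of_smooth hΩ.1 hη hφ i h1, ← eLpNorm_congr_ae h2] at h3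
        have h4 := ENNReal.toReal_mono (ENNReal.mul_ne_top hC (Lp.eLpNorm_ne_top _)) h3
        rw [ENNReal.toReal_mul, toReal_enorm] at h4
        exact h4
      have hmem : (w, (0 : Lp ℂ 2 (surface Ω))) ∈
          closure (smoothTraceGraph γ Ω : Set (H1 γ Ω × Lp ℂ 2 (surface Ω))) := hw
      have h5 := closure_minimal hsub hcl hmem
      simp only [mem_ofPred_eq, norm_zero, mul_zero] at h5
      exact norm_le_zero_iff.1 h5
    by_cases hxΩ : x ∈ Ω
    · refine ⟨Ω, hΩ.1, hxΩ, fun η hη hηΩ => ?_⟩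
      rw [hasWeakDeriv_gradOf w i η ⟨hη.1, hη.2, hηΩ⟩, neg_add_cancel]
    · refine ⟨(closure Ω)ᶜ, isClosed_closure.isOpen_compl, fun hxc => hx ?_,
        fun η hη hηΩ => ?_⟩
      · rw [hΩ.1.frontier_eq]
        exact ⟨hxc, hxΩ⟩
      · have hz : ∀ y ∈ Ω, y ∉ tsupport η := fun y hy hh => hηΩ hh (subset_closure hy)
        rw [setIntegral_eq_zero_of_forall_eq_zero fun y hy => by
            rw [image_eq_zero_of_notMem_tsupport
              fun hh => hz y hy (tsupport_pderiv_subset η i hh), mul_zero],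
          setIntegral_eq_zero_of_forall_eq_zero fun y hy => by
            rw [image_eq_zero_of_notMem_tsupport (hz y hy), mul_zero], add_zero]

/-- Functions with trace zero on a Lipschitz domain extend by zero to `H¹(ℝ^d)`. -/
lemma exists_zero_extension {n : ℕ} (hγ : 0 < γ) {Ω : Set (Space (n + 1))}
    (hΩ : IsLipschitzOpen Ω) {w : H1 γ Ω} (hw : w ∈ traceZero γ Ω) :
    ∃ W : H1 γ (univ : Set (Space (n + 1))),
      fnOf W =ᵐ[volume.restrict univ] Ω.indicator (fnOf w) ∧
      ∀ i, gradOf W i =ᵐ[volume.restrict univ] Ω.indicator (gradOf w i) := by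
  have hm := hΩ.1.measurableSet
  have hL : ∀ f : L2 Ω, MemLp (Ω.indicator f) 2 (volume.restrict univ) := fun f => by
    rw [Measure.restrict_univ, memLp_indicator_iff_restrict hm]
    exact Lp.memLp f
  refine exists_H1 hγ (hL _) (fun i => hL _) fun i η hη => ?_
  have e : ∀ (f : L2 Ω) (g : Space (n + 1) → ℂ),
      ∫ x in univ, Ω.indicator f x * g x = ∫ x in Ω, f x * g x := fun f g => by
    rw [setIntegral_univ, ← integral_indicator hm]
    congr 1
    ext x
    by_cases hx : x ∈ Ω <;> simp [hx]
  rw [e, e]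
  exact eq_neg_of_add_eq_zero_left (boundaryTerm_eq_zero hΩ hw i hη.smooth)

end

noncomputable section

/-! ### Gluing over the partition -/

lemma conjH1_resH1 {d : ℕ} {γ : ℝ} {Ω : Set (Space d)} (φ : H1 γ (univ : Set (Space d))) :
    conjH1 (resH1 γ Ω φ) = resH1 γ Ω (conjH1 φ) := by
  apply Subtype.ext
  ext1 k
  apply Lp.ext
  change (star (resL2 Ω (φ.1 k)) : L2 Ω) =ᵐ[volume.restrict Ω] resL2 Ω (star (φ.1 k))
  filter_upwards [Lp.coeFn_star (resL2 Ω (φ.1 k)), coeFn_resL2 Ω (φ.1 k),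
    coeFn_resL2 Ω (star (φ.1 k)), ae_eq_of_univ (Ω := Ω) (Lp.coeFn_star (φ.1 k))]
    with x h1 h2 h3 h4
  rw [h1, h3, h4, Pi.star_apply, Pi.star_apply, h2]

section Partition

variable {n J : ℕ} {γ : ℝ} {Ω : Fin (J + 1) → Set (Space (n + 1))}

lemma IsLipschitzPartition.isOpen (hΩ : IsLipschitzPartition Ω) (j : Fin (J + 1)) :
    IsOpen (Ω j) := (hΩ.lipschitz j).1

/-- The subdomains cover `ℝ^d` up to their boundaries, which are null sets. -/
lemma IsLipschitzPartition.iUnion_ae_eq (hΩ : IsLipschitzPartition Ω) :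
    (⋃ j, Ω j : Set (Space (n + 1))) =ᵐ[volume] (univ : Set (Space (n + 1))) := by
  rw [Filter.eventuallyEq_univ]
  have h0 : volume (⋃ j, frontier (Ω j)) = 0 :=
    measure_iUnion_null fun j => (hΩ.lipschitz j).volume_frontier
  refine measure_mono_null (fun x hx => ?_) h0
  have hx1 : x ∈ ⋃ j, closure (Ω j) := by rw [hΩ.cover]; trivial
  obtain ⟨j, hj⟩ := mem_iUnion.1 hx1
  refine mem_iUnion.2 ⟨j, ?_⟩
  rw [(hΩ.isOpen j).frontier_eq]
  exact ⟨hj, fun hxj => hx (mem_iUnion.2 ⟨j, hxj⟩)⟩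

lemma IsLipschitzPartition.integral_eq_sum (hΩ : IsLipschitzPartition Ω)
    {F : Space (n + 1) → ℂ} (hF : Integrable F) :
    ∫ x, F x = ∑ j, ∫ x in Ω j, F x := by
  rw [← setIntegral_univ, ← setIntegral_congr_set hΩ.iUnion_ae_eq,
    integral_iUnion_fintype (fun j => (hΩ.isOpen j).measurableSet)
      (fun j k hjk => hΩ.disjoint j k hjk) fun j => hF.integrableOn]

lemma integrable_green_univ {d : ℕ} {ψ : Fin d → Space d → ℂ} {f : Space d → ℂ}
    (hψ : ∀ i, MemLp (ψ i) 2) (hf : MemLp f 2) (w : H1 γ (univ : Set (Space d))) :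
    Integrable (fun x => (∑ i, ψ i x * gradOf w i x) + f x * fnOf w x) :=
  (integrable_finsetSum _ fun i _ =>
    integrable_mul_of_memLp_volume (hψ i) (memLp_of_restrict_univ (Lp.memLp _))).add
    (integrable_mul_of_memLp_volume hf (memLp_of_restrict_univ (Lp.memLp _)))

lemma setIntegral_green_resH1 {d : ℕ} {Ω : Set (Space d)} {ψ ψ' : Fin d → Space d → ℂ}
    {f f' : Space d → ℂ} (hψ : ∀ i, ψ i =ᵐ[volume.restrict Ω] ψ' i)
    (hf : f =ᵐ[volume.restrict Ω] f') (w : H1 γ (univ : Set (Space d))) :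
    ∫ x in Ω, ((∑ i, ψ i x * gradOf (resH1 γ Ω w) i x) + f x * fnOf (resH1 γ Ω w) x) =
      ∫ x in Ω, ((∑ i, ψ' i x * gradOf w i x) + f' x * fnOf w x) := by
  refine integral_congr_ae ?_
  filter_upwards [ae_all_iff.2 hψ, hf, fnOf_resH1 w,
    ae_all_iff.2 fun i => gradOf_resH1 (Ω := Ω) w i] with x h1 h2 h3 h4
  simp only [h1, h2, h3, h4]

/-- The scalar product of `H¹(ℝ^d)` is the sum of those of the subdomains. -/
lemma inner_conjH1_eq_sum (hγ : 0 < γ) (hΩ : IsLipschitzPartition Ω)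
    (a b : H1 γ (univ : Set (Space (n + 1)))) :
    inner ℂ (conjH1 a) b = ∑ j, inner ℂ (conjH1 (resH1 γ (Ω j) a)) (resH1 γ (Ω j) b) := by
  rw [inner_conjH1 hγ, setIntegral_univ, hΩ.integral_eq_sum (integrable_green_univ
    (fun i => memLp_of_restrict_univ (Lp.memLp (gradOf a i)))
    ((memLp_of_restrict_univ (Lp.memLp (fnOf a))).const_mul ((γ : ℂ)⁻¹ ^ 2)) b)]
  refine Finset.sum_congr rfl fun j _ => ?_
  rw [inner_conjH1 hγ]
  refine (setIntegral_green_resH1 (fun i => gradOf_resH1 a i) ?_ b).symm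
  filter_upwards [fnOf_resH1 (Ω := Ω j) a] with x hx
  rw [hx]

/-- Single-trace Neumann data annihilate single-trace Dirichlet data. -/
lemma sum_singleNeu_apply {p : MultiNeu γ Ω} (hΩ : IsLipschitzPartition Ω)
    (hp : p ∈ singleNeu γ Ω) (φ : H1 γ (univ : Set (Space (n + 1)))) :
    ∑ j, p j (trace (resH1 γ (Ω j) φ)) = 0 := by
  obtain ⟨ψ, f, h, hpj⟩ := hp
  rw [← green_univ h φ, hΩ.integral_eq_sum (integrable_green_univ
    (fun i => memLp_of_restrict_univ (h.memLp i)) (memLp_of_restrict_univ h.memLp_div) φ)]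
  refine Finset.sum_congr rfl fun j _ => ?_
  rw [hpj j]
  exact setIntegral_green_resH1 (fun i => .rfl) .rfl φ

lemma multiNtd_symm_neuInner (p : MultiNeu γ Ω) (u : MultiDir γ Ω) :
    neuInner (multiNtd γ Ω) ((multiNtd γ Ω).symm u) p =
      ∑ j, (starRingEnd ℂ) (p j (conjDir (u j))) := by
  rw [neuInner, LinearEquiv.apply_symm_apply]

set_option maxHeartbeats 1000000 in
lemma neuInner_singleNeu_singleDir (hγ : 0 < γ) (hΩ : IsLipschitzPartition Ω)
    {p : MultiNeu γ Ω} (hp : p ∈ singleNeu γ Ω) {u : MultiDir γ Ω} (hu : u ∈ singleDir γ Ω) :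
    neuInner (multiNtd γ Ω) p ((multiNtd γ Ω).symm u) = 0 := by
  obtain ⟨φ, hφ⟩ := (mem_singleDir_iff hγ hΩ.isOpen).1 hu
  rw [neuInner_conj_symm, multiNtd_symm_neuInner, ← map_sum, Complex.conj_conj]
  simp_rw [hφ, trace_conjH1, conjH1_resH1]
  exact sum_singleNeu_apply hΩ hp (conjH1 φ)

set_option maxHeartbeats 1000000 in
/-- Neumann data in equilibrium with every `H¹(ℝ^d)` function are single traces: the gradients of
the Neumann solutions in the subdomains glue to a field in `H(div, ℝ^d)`. -/
lemma mem_singleNeu_of_sum_eq_zero (hγ : 0 < γ) (hΩ : IsLipschitzPartition Ω)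
    {q : MultiNeu γ Ω}
    (hq : ∀ W : H1 γ (univ : Set (Space (n + 1))), ∑ j, q j (trace (resH1 γ (Ω j) W)) = 0) :
    q ∈ singleNeu γ Ω := by
  -- gluing of functions given on the subdomains
  let glue : (∀ j, Space (n + 1) → ℂ) → Space (n + 1) → ℂ := fun v x =>
    ∑ j : Fin (J + 1), (Ω j).indicator (v j) x
  have hglue : ∀ v j, ∀ x ∈ Ω j, glue v x = v j x := by
    intro v j x hx
    simp only [glue]
    rw [Finset.sum_eq_single j, indicator_of_mem hx]
    · intro k _ hk
      exact indicator_of_notMem (disjoint_left.1 (hΩ.disjoint j k hk.symm) hx) _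
    · simp
  have hae : ∀ v j, glue v =ᵐ[volume.restrict (Ω j)] v j := fun v j => by
    filter_upwards [ae_restrict_mem (hΩ.isOpen j).measurableSet] with x hx
    exact hglue v j x hx
  have hmem : ∀ v, (∀ j, MemLp (v j) 2 (volume.restrict (Ω j))) → MemLp (glue v) 2 :=
    fun v hv => memLp_finsetSum _ fun j _ =>
      (memLp_indicator_iff_restrict (hΩ.isOpen j).measurableSet).2 (hv j)
  set ψ : Fin (n + 1) → Space (n + 1) → ℂ := fun i =>
    glue fun j => gradOf (neumannSol (q j)) i with hψ
  set f : Space (n + 1) → ℂ :=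
    glue fun j x => (γ : ℂ)⁻¹ ^ 2 * fnOf (neumannSol (q j)) x with hf
  have hψL : ∀ i, MemLp (ψ i) 2 := fun i => hmem _ fun j => Lp.memLp _
  have hfL : MemLp f 2 := hmem _ fun j => (Lp.memLp _).const_mul _
  have hn : ∀ j, IsNormalTrace γ (Ω j) ψ f (q j) := fun j w => by
    rw [isNormalTrace_neumannSol hγ (q j) w]
    refine integral_congr_ae ?_
    filter_upwards [ae_restrict_mem (hΩ.isOpen j).measurableSet] with x hx
    simp only [hψ, hf]
    simp only [hglue _ j x hx]
  refine ⟨ψ, f, ⟨fun i => (hψL i).restrict univ, hfL.restrict univ, fun η hη => ?_⟩, hn⟩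
  obtain ⟨W, hW, hW'⟩ := exists_H1_of_smooth (Ω := univ) hγ hη.smooth
  have h0 := hq W
  have h1 : ∀ j, q j (trace (resH1 γ (Ω j) W)) =
      ∫ x in Ω j, ((∑ i, ψ i x * gradOf W i x) + f x * fnOf W x) := fun j => by
    rw [hn j]
    exact setIntegral_green_resH1 (fun i => .rfl) .rfl W
  simp_rw [h1] at h0
  rw [← hΩ.integral_eq_sum (integrable_green_univ hψL hfL W), ← setIntegral_univ] at h0
  rw [← add_eq_zero_iff_eq_neg, ← integral_add, ← h0]
  · refine integral_congr_ae ?_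
    filter_upwards [hW, ae_all_iff.2 hW'] with x h2 h3
    simp only [h2, h3]
  · exact integrable_finsetSum _ fun i _ =>
      integrable_mul_of_memLp ((hψL i).restrict univ) (hη.smooth.memLp_pderiv univ i)
  · exact integrable_mul_of_memLp (hfL.restrict univ) (hη.smooth.memLp univ)

set_option maxHeartbeats 1000000 in
/-- A functional `W ↦ ∑_j ⟨p^j, W|_∂Ω_j⟩` on `H¹(ℝ^d)` is represented by a function whose restriction
to each subdomain is orthogonal to the functions with trace zero: these extend by zero to `ℝ^d`, and
the functional vanishes on the extensions. -/
lemma exists_transmission_solution (hγ : 0 < γ) (hΩ : IsLipschitzPartition Ω)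
    (p : MultiNeu γ Ω) :
    ∃ (φ : H1 γ (univ : Set (Space (n + 1)))) (t : MultiNeu γ Ω),
      (∀ j, neumannSol (t j) = resH1 γ (Ω j) φ) ∧
      ∀ W : H1 γ (univ : Set (Space (n + 1))),
        ∑ j, p j (trace (resH1 γ (Ω j) W)) = inner ℂ (conjH1 φ) W := by
  let F : StrongDual ℂ (H1 γ (univ : Set (Space (n + 1)))) :=
    ∑ j, (pullback (p j)).comp (resH1 γ (Ω j))
  have hF : ∀ W, F W = ∑ j, p j (trace (resH1 γ (Ω j) W)) := fun W => by
    simp only [F, _root_.sum_apply, ContinuousLinearMap.comp_apply, pullback_apply]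
  set φ : H1 γ (univ : Set (Space (n + 1))) :=
    conjH1 ((InnerProductSpace.toDual ℂ (H1 γ univ)).symm F) with hφ
  have hrep : ∀ W, ∑ j, p j (trace (resH1 γ (Ω j) W)) = inner ℂ (conjH1 φ) W := fun W => by
    rw [hφ, conjH1_conjH1, InnerProductSpace.toDual_symm_apply, hF]
  have horth : ∀ j, ∀ w ∈ traceZero γ (Ω j), inner ℂ (conjH1 (resH1 γ (Ω j) φ)) w = 0 := by
    intro j w hw
    obtain ⟨W, hW, -⟩ := exists_zero_extension hγ (hΩ.lipschitz j) hw
    have hj : resH1 γ (Ω j) W = w := by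
      refine H1_ext hγ (hΩ.isOpen j) ((fnOf_resH1 W).trans ?_)
      filter_upwards [ae_eq_of_univ (Ω := Ω j) hW,
        ae_restrict_mem (hΩ.isOpen j).measurableSet] with x h1 h2
      rw [h1, indicator_of_mem h2]
    have hk : ∀ k, k ≠ j → resH1 γ (Ω k) W = 0 := by
      intro k hkj
      refine H1_ext hγ (hΩ.isOpen k) ((fnOf_resH1 W).trans ?_)
      have e0 : fnOf (0 : H1 γ (Ω k)) = 0 := by simp [fnOf]
      rw [e0]
      filter_upwards [ae_eq_of_univ (Ω := Ω k) hW,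
        ae_restrict_mem (hΩ.isOpen k).measurableSet, Lp.coeFn_zero ℂ 2 (volume.restrict (Ω k))]
        with x h1 h2 h3
      rw [h1, h3, indicator_of_notMem (disjoint_left.1 (hΩ.disjoint k j hkj) h2)]
      rfl
    have h1 := hrep W
    rw [inner_conjH1_eq_sum hγ hΩ, Finset.sum_eq_single j, Finset.sum_eq_single j, hj,
      trace_eq_zero.2 hw, map_zero] at h1
    · exact h1.symm
    · intro k _ hkj
      rw [hk k hkj, inner_zero_right]
    · simp
    · intro k _ hkj
      rw [hk k hkj, map_zero, map_zero]
    · simp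
  choose t ht using fun j => exists_neumannSol_eq (horth j)
  exact ⟨φ, WithLp.toLp 2 t, ht, hrep⟩

set_option maxHeartbeats 1000000 in
lemma isCompl_singleNeu_map_singleDir (hγ : 0 < γ) (hΩ : IsLipschitzPartition Ω) :
    IsCompl (singleNeu γ Ω) ((singleDir γ Ω).map
      ((multiNtd γ Ω).symm : MultiDir γ Ω →ₗ[ℂ] MultiNeu γ Ω)) := by
  constructor
  · rw [Submodule.disjoint_def]
    rintro p hp ⟨u, hu, rfl⟩
    have h1 := neuInner_singleNeu_singleDir hγ hΩ hp hu
    exact eq_zero_of_neuInner_self h1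
  · rw [codisjoint_iff, Submodule.eq_top_iff']
    intro p
    obtain ⟨φ, t, ht, hrep⟩ := exists_transmission_solution hγ hΩ p
    refine Submodule.mem_sup.2 ⟨p - t, ?_, t, ⟨multiNtd γ Ω t, ?_, ?_⟩, sub_add_cancel _ _⟩
    · refine mem_singleNeu_of_sum_eq_zero hγ hΩ fun W => ?_
      have h1 : ∀ j, (p - t) j (trace (resH1 γ (Ω j) W)) = p j (trace (resH1 γ (Ω j) W)) -
          inner ℂ (conjH1 (resH1 γ (Ω j) φ)) (resH1 γ (Ω j) W) := fun j => by
        rw [← ht j, inner_neumannSol]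
        rfl
      simp_rw [h1]
      rw [Finset.sum_sub_distrib, hrep, inner_conjH1_eq_sum hγ hΩ, sub_self]
    · refine (mem_singleDir_iff hγ hΩ.isOpen).2 ⟨φ, fun j => ?_⟩
      rw [multiNtd_apply, ht]
    · exact LinearEquiv.symm_apply_apply _ _

end Partition

end

end MultiTrace

theorem mainTheorem10 (d : ℕ) (hd1 : 1 ≤ d) (hd3 : d ≤ 3) (γ : ℝ) (hγ : 0 < γ) (J : ℕ)
    (Ω : Fin (J + 1) → Set (MultiTrace.Space d)) (hΩ : MultiTrace.IsLipschitzPartition Ω) :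
    ∃ T : MultiTrace.MultiDir γ Ω ≃ₗ[ℂ] MultiTrace.MultiNeu γ Ω,
      (∀ (u : MultiTrace.MultiDir γ Ω) (p : MultiTrace.MultiNeu γ Ω),
        T u = p ↔ ∀ j, MultiTrace.IsDtN γ (Ω j) (u j) (p j)) ∧
      (∀ p q : MultiTrace.MultiNeu γ Ω, MultiTrace.neuInner T.symm q p =
        (starRingEnd ℂ) (MultiTrace.neuInner T.symm p q)) ∧
      (∀ p : MultiTrace.MultiNeu γ Ω, MultiTrace.neuInner T.symm p p = ((‖p‖ ^ 2 : ℝ) : ℂ)) ∧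
      IsCompl (MultiTrace.singleNeu γ Ω)
        ((MultiTrace.singleDir γ Ω).map (T : MultiTrace.MultiDir γ Ω →ₗ[ℂ] MultiTrace.MultiNeu γ Ω)) ∧
      ∀ p ∈ MultiTrace.singleNeu γ Ω, ∀ u ∈ MultiTrace.singleDir γ Ω,
        MultiTrace.neuInner T.symm p (T u) = 0 := by
  cases d with
  | zero => exact absurd hd1 (by norm_num)
  | succ n =>
  refine ⟨(MultiTrace.multiNtd γ Ω).symm, fun u p => ?_, MultiTrace.neuInner_conj_symm,
    MultiTrace.neuInner_self, MultiTrace.isCompl_singleNeu_map_singleDir hγ hΩ,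
    fun p hp u hu => MultiTrace.neuInner_singleNeu_singleDir hγ hΩ hp hu⟩
  rw [LinearEquiv.symm_apply_eq]
  constructor
  · rintro rfl j
    exact (MultiTrace.isDtN_iff hγ (hΩ.isOpen j)).2 rfl
  · intro h
    ext1 j
    exact ((MultiTrace.isDtN_iff hγ (hΩ.isOpen j)).1 (h j)).symm
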